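/- Let $S^1=[-\pi,\pi]$ with endpoints identified. For $k\ge 0$ let $\mathcal H^k(S^1)$ be the Sobolev space of real $2\pi$-periodic functions $f$ whose weak derivatives $f^{(s)}$, $0\le s\le k$, lie in $L^2(-\pi,\pi)$, with norm $\|f\|_{\mathcal H^k}=\big(\sum_{s=0}^k\|f^{(s)}\|_{L^2}^2\big)^{1/2}$, and let $H$ be the periodic Hilbert transform $$Hf(x)=\frac1{2\pi}\,\mathrm{P.V.}\!\int_{-\pi}^{\pi} f(y)\cot\Big(\frac{x-y}{2}\Big)\,dy .$$ Let $a\in\mathbb R$, $0<T<\infty$, $n\ge 2$ and $\Omega_0,\omega_0\in\mathcal H^n(S^1)$. Let $(\Omega,\omega)$ with $\Omega,\omega\in C([0,T);\mathcal H^1(S^1))$ be a solution on $[0,T)$, with initial data $(\Omega_0,\omega_0)$, of $$\Omega_t+a\,m\,\Omega_x-\omega\, p_x=0,\qquad \omega_t+a\,p\,\omega_x-\Omega\, m_x=0,\qquad p_x=H\Omega,\quad m_x=H\omega,$$ where $p(t,\cdot)$ and $m(t,\cdot)$ are periodic with $\int_{-\pi}^{\pi}p\,dx=\int_{-\pi}^{\pi}m\,dx=0$,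 and where the first two equations hold in $L^2(S^1)$ for every $t\in[0,T)$, $\Omega_t$ and $\omega_t$ being the time derivatives of $\Omega,\omega$ as $L^2(S^1)$-valued maps (one-sided at $t=0$). Then: 1. $\Omega(t),\omega(t)\in\mathcal H^n(S^1)$ for every $t\in[0,T)$, and $\displaystyle\sup_{0\le t\le T'}\big(\|\Omega(t)\|_{\mathcal H^n}+\|\omega(t)\|_{\mathcal H^n}\big)<\infty$ for every $T'<T$. 2. If the $\mathcal H^1$ norms of $\Omega$ and $\omega$ are bounded on $[0,T)$ (in particular, if $\Omega,\omega$ extend to elements of $C([0,T];\mathcal H^1(S^1))$), then $$\sup_{0\le t<T}\big(\|\Omega(t)\|_{\mathcal H^n}+\|\omega(t)\|_{\mathcal H^n}\big)<\infty .$$ -/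

import Mathlib

open MeasureTheory Set Filter Topology Real

noncomputable section

/-- `L²(S¹)`, where `S¹ = [-π, π]` with endpoints identified: real square integrable functions on
one period, modulo equality almost everywhere, with `‖f‖² = ∫_{-π}^{π} |f|²`. -/
abbrev CircleL2 : Type := Lp ℝ 2 (volume.restrict (Ioc (-π) π))

/-- `g` is the derivative of `f` in the sense of periodic distributions. Testing against all smooth
`2π`-periodic functions (which need not vanish at `±π`) encodes the periodicity of `f`. -/
def HasWeakDeriv (f g : CircleL2) : Prop :=
  ∀ φ : ℝ → ℝ, ContDiff ℝ (⊤ : ℕ∞) φ → Function.Periodic φ (2 * π) →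
    ∫ x in Ioc (-π) π, f x * deriv φ x = - ∫ x in Ioc (-π) π, g x * φ x

/-- The product of an `L²` function with a continuous function is integrable on a period. -/
theorem CircleL2.integrable_mul_continuous (f : CircleL2) {φ : ℝ → ℝ} (hφ : Continuous φ) :
    Integrable (fun x => f x * φ x) (volume.restrict (Ioc (-π) π)) := by
  have hf : Integrable f (volume.restrict (Ioc (-π) π)) :=
    (Lp.memLp f).integrable (by norm_num)
  obtain ⟨C, hC⟩ := (isCompact_Icc (a := -π) (b := π)).exists_bound_of_continuousOn hφ.continuousOn
  refine hf.mul_bdd (c := C) hφ.aestronglyMeasurable ?_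
  filter_upwards [ae_restrict_mem measurableSet_Ioc] with x hx
  exact hC x (Ioc_subset_Icc_self hx)

theorem HasWeakDeriv.zero : HasWeakDeriv 0 0 := by
  intro φ _ _
  have h0 : ((0 : CircleL2) : ℝ → ℝ) =ᵐ[volume.restrict (Ioc (-π) π)] 0 := Lp.coeFn_zero _ _ _
  have key : ∀ ψ : ℝ → ℝ, ∫ x in Ioc (-π) π, (0 : CircleL2) x * ψ x = 0 := by
    intro ψ
    refine integral_eq_zero_of_ae ?_
    filter_upwards [h0] with x hx
    simp only [hx, Pi.zero_apply, zero_mul]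
  rw [key, key, neg_zero]

theorem HasWeakDeriv.add {f₁ g₁ f₂ g₂ : CircleL2} (h₁ : HasWeakDeriv f₁ g₁)
    (h₂ : HasWeakDeriv f₂ g₂) : HasWeakDeriv (f₁ + f₂) (g₁ + g₂) := by
  intro φ hφ hp
  have key : ∀ (u v : CircleL2) (ψ : ℝ → ℝ), Continuous ψ →
      ∫ x in Ioc (-π) π, (u + v : CircleL2) x * ψ x =
        (∫ x in Ioc (-π) π, u x * ψ x) + ∫ x in Ioc (-π) π, v x * ψ x := by
    intro u v ψ hψ
    rw [← integral_add (u.integrable_mul_continuous hψ) (v.integrable_mul_continuous hψ)]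
    refine integral_congr_ae ?_
    filter_upwards [Lp.coeFn_add u v] with x hx
    simp only [hx, Pi.add_apply]
    ring
  rw [key _ _ _ (hφ.continuous_deriv (by simp)), key _ _ _ hφ.continuous, h₁ φ hφ hp, h₂ φ hφ hp]
  ring

theorem HasWeakDeriv.smul {f g : CircleL2} (c : ℝ) (h : HasWeakDeriv f g) :
    HasWeakDeriv (c • f) (c • g) := by
  intro φ hφ hp
  have key : ∀ (u : CircleL2) (ψ : ℝ → ℝ),
      ∫ x in Ioc (-π) π, (c • u : CircleL2) x * ψ x = c * ∫ x in Ioc (-π) π, u x * ψ x := by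
    intro u ψ
    rw [← integral_const_mul]
    refine integral_congr_ae ?_
    filter_upwards [Lp.coeFn_smul c u] with x hx
    simp only [hx, Pi.smul_apply, smul_eq_mul]
    ring
  rw [key, key, h φ hφ hp]
  ring

/-- The Sobolev space `Hᵏ(S¹)`. A function is recorded together with its weak derivatives
`(f, f', …, f⁽ᵏ⁾)`, all in `L²(S¹)`, so that the norm inherited from the `ℓ²`-product is
`(∑_{s ≤ k} ‖f⁽ˢ⁾‖²)^{1/2}`. -/
def SobolevSpace (k : ℕ) : Submodule ℝ (PiLp 2 (fun _ : Fin (k + 1) => CircleL2)) where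
  carrier := {F | ∀ s : Fin k, HasWeakDeriv (F s.castSucc) (F s.succ)}
  zero_mem' := fun _ => HasWeakDeriv.zero
  add_mem' := fun hF hG s => (hF s).add (hG s)
  smul_mem' := fun c _ hF s => (hF s).smul c

/-- The `s`-th weak derivative `f⁽ˢ⁾` (`0 ≤ s ≤ k`) of `f ∈ Hᵏ(S¹)`; `weakDeriv f 0` is `f` itself. -/
def weakDeriv {k : ℕ} (f : SobolevSpace k) (s : Fin (k + 1)) : CircleL2 := f.1 s

/-- `g = H f`: the principal value
`(1 / 2π) P.V. ∫_{-π}^{π} f(y) cot((x - y) / 2) dy` exists and equals `g(x)` for a.e. `x`. -/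
def IsHilbertTransform (f g : CircleL2) : Prop :=
  ∀ᵐ x ∂(volume.restrict (Ioc (-π) π)),
    Tendsto (fun ε : ℝ => 1 / (2 * π) *
        ∫ y in {y : ℝ | y ∈ Ioc (-π) π ∧ ε < |x - y|}, f y * Real.cot ((x - y) / 2))
      (𝓝[>] 0) (𝓝 (g x))

/-- `p` is the zero-mean periodic function with `p_x = H f`. -/
def IsVelocityOf (f p : SobolevSpace 1) : Prop :=
  IsHilbertTransform (weakDeriv f 0) (weakDeriv p 1) ∧ ∫ x in Ioc (-π) π, weakDeriv p 0 x = 0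

/-- `(Ω, ω)` is a solution on `[0, T)`, with velocities `p` and `m`, of
```
Ω_t + a m Ω_x - ω p_x = 0,   ω_t + a p ω_x - Ω m_x = 0,   p_x = H Ω,   m_x = H ω,
```
where `p(t)` and `m(t)` have mean zero, the time derivatives are those of the `L²(S¹)`-valued maps
`Ω` and `ω` (one-sided at `t = 0`), and the equations hold almost everywhere in `x`. -/
structure IsMHDSolution (a T : ℝ) (Ω ω p m : ℝ → SobolevSpace 1) : Prop where
  velocity_p : ∀ t ∈ Ico 0 T, IsVelocityOf (Ω t) (p t)
  velocity_m : ∀ t ∈ Ico 0 T, IsVelocityOf (ω t) (m t)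
  eq_Ω : ∀ t ∈ Ico 0 T, ∃ Ωt : CircleL2,
    HasDerivWithinAt (fun s => weakDeriv (Ω s) 0) Ωt (Ico 0 T) t ∧
    ∀ᵐ x ∂(volume.restrict (Ioc (-π) π)),
      Ωt x + a * weakDeriv (m t) 0 x * weakDeriv (Ω t) 1 x
        - weakDeriv (ω t) 0 x * weakDeriv (p t) 1 x = 0
  eq_ω : ∀ t ∈ Ico 0 T, ∃ ωt : CircleL2,
    HasDerivWithinAt (fun s => weakDeriv (ω s) 0) ωt (Ico 0 T) t ∧
    ∀ᵐ x ∂(volume.restrict (Ioc (-π) π)),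
      ωt x + a * weakDeriv (p t) 0 x * weakDeriv (ω t) 1 x
        - weakDeriv (Ω t) 0 x * weakDeriv (m t) 1 x = 0

/-- For every `t ∈ I` both `Ω(t)` and `ω(t)` belong to `Hⁿ(S¹)`, and
`sup_{t ∈ I} (‖Ω(t)‖_{Hⁿ} + ‖ω(t)‖_{Hⁿ}) < ∞`. -/
def SobolevBoundedOn (n : ℕ) (Ω ω : ℝ → SobolevSpace 1) (I : Set ℝ) : Prop :=
  ∃ C : ℝ, ∀ t ∈ I, ∃ U V : SobolevSpace n,
    weakDeriv U 0 = weakDeriv (Ω t) 0 ∧ weakDeriv V 0 = weakDeriv (ω t) 0 ∧ ‖U‖ + ‖V‖ ≤ C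

end

/-! The proof is an energy estimate on Fourier coefficients. For `f` in `H¹` the principal value
acts as the multiplier `-i sgn k` (`coef_of_isHilbertTransform`), so the coefficients of `p_x` are
dominated by those of `Ω`, and `|k| |m̂(k)| ≤ |ω̂(k)|`: each velocity is one derivative smoother
than its source. The low-order quantity that governs growth is `∑ |Ω̂(k)| + ∑ |ω̂(k)|`, which the
`H¹` norms bound.

Let `v(k)` be a weight comparable to `|k|ⁿ` and `E = ∑ v(k)² (|Ω̂(k)|² + |ω̂(k)|²)`. In the
stretching term, `v(k) ≲ v(j) + v(k-j)` moves one weight onto the factors of the convolution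
(`stretching_bound`). The transport term seems to lose a derivative; since the velocity is real,
symmetrizing in `(k, j)` replaces `v(k)² j` by `v(k)² j - v(j)² k`. This is `O(|k-j|)` times
products of two weights (`truncWeight_commutator`), and the velocity coefficient at `k-j` absorbs
the factor `|k-j|` (`transport_bound`). Hence `E' ≤ C (∑ |Ω̂| + ∑ |ω̂|) E`, linear in `E`, and
Grönwall's inequality closes the argument on a bounded time interval.

Finiteness of `E` for positive times is part of the claim, and `Ω`, `ω` are differentiable in time
only as `L²`-valued maps. The weight is therefore `(1 + min(|k|, N))ⁿ`, a bounded multiplier on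
`L²`. Both weight inequalities hold with constants independent of `N`, so `weighted_energy_le` is
uniform in `N`, and the full weight is recovered on finite sets of frequencies. -/

/-! ### Characters, Fourier coefficients and Parseval on one period. -/

/-- Lebesgue measure on one period. -/
noncomputable abbrev periodMeasure : Measure ℝ := volume.restrict (Ioc (-π) π)

/-- The character `x ↦ e^{ikx}`. -/
noncomputable def expChar (k : ℤ) (x : ℝ) : ℂ := Complex.exp (k * x * Complex.I)

/-- The `k`-th Fourier coefficient of a complex function on one period. -/
noncomputable def fourierInt (f : ℝ → ℂ) (k : ℤ) : ℂ :=
  (2 * π : ℂ)⁻¹ * ∫ x in Ioc (-π) π, expChar (-k) x * f x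

theorem expChar_zero (x : ℝ) : expChar 0 x = 1 := by simp [expChar]

theorem expChar_add (j k : ℤ) (x : ℝ) : expChar (j + k) x = expChar j x * expChar k x := by
  simp only [expChar, ← Complex.exp_add]; congr 1; push_cast; ring

theorem conj_expChar (k : ℤ) (x : ℝ) : (starRingEnd ℂ) (expChar k x) = expChar (-k) x := by
  simp only [expChar, ← Complex.exp_conj]; congr 1; simp

theorem norm_expChar (k : ℤ) (x : ℝ) : ‖expChar k x‖ = 1 := by
  have : (k * x * Complex.I : ℂ) = ((k * x : ℝ) : ℂ) * Complex.I := by push_cast; ring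
  rw [expChar, this, Complex.norm_exp_ofReal_mul_I]

theorem continuous_expChar (k : ℤ) : Continuous (expChar k) := by
  unfold expChar; fun_prop

theorem expChar_eq_fourier (k : ℤ) (x : ℝ) :
    expChar k x = fourier k (x : AddCircle (2 * π)) := by
  rw [fourier_coe_apply, expChar]
  congr 1
  have : (π : ℂ) ≠ 0 := by exact_mod_cast pi_ne_zero
  push_cast
  field_simp

theorem fourierInt_eq_fourierCoeffOn (f : ℝ → ℂ) (k : ℤ) (h : -π < π) :
    fourierInt f k = fourierCoeffOn h f k := by
  rw [fourierCoeffOn_eq_integral, fourierInt, intervalIntegral.integral_of_le h.le]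
  have h2 : π - -π = 2 * π := by ring
  rw [h2]
  simp_rw [expChar_eq_fourier, smul_eq_mul]
  rw [Complex.real_smul]
  push_cast
  simp

theorem neg_pi_lt_pi : -π < π := by linarith [pi_pos]

theorem MeasureTheory.MemLp.mul_expChar {f : ℝ → ℂ} (hf : MemLp f 2 periodMeasure) (k : ℤ) :
    MemLp (fun x => expChar k x * f x) 2 periodMeasure := by
  refine hf.of_le ((continuous_expChar k).aestronglyMeasurable.mul hf.1) ?_
  exact ae_of_all _ fun x => by simp [norm_expChar]

theorem integrable_expChar_mul {f : ℝ → ℂ} (hf : Integrable f periodMeasure) (k : ℤ) :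
    Integrable (fun x => expChar k x * f x) periodMeasure := by
  refine hf.mono ((continuous_expChar k).aestronglyMeasurable.mul hf.1) ?_
  exact ae_of_all _ fun x => by simp [norm_expChar]

theorem MeasureTheory.MemLp.integrable_period {f : ℝ → ℂ} (hf : MemLp f 2 periodMeasure) :
    Integrable f periodMeasure := hf.integrable (by norm_num)

theorem hasSum_sq_fourierInt {f : ℝ → ℂ} (hf : MemLp f 2 periodMeasure) :
    HasSum (fun k => ‖fourierInt f k‖ ^ 2) ((2 * π)⁻¹ * ∫ x in Ioc (-π) π, ‖f x‖ ^ 2) := by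
  have h := hasSum_sq_fourierCoeffOn neg_pi_lt_pi hf
  have h2 : π - -π = 2 * π := by ring
  rw [h2, intervalIntegral.integral_of_le neg_pi_lt_pi.le, smul_eq_mul] at h
  simpa only [fourierInt_eq_fourierCoeffOn _ _ neg_pi_lt_pi] using h

theorem fourierInt_add {f g : ℝ → ℂ} (hf : Integrable f periodMeasure)
    (hg : Integrable g periodMeasure) (k : ℤ) :
    fourierInt (fun x => f x + g x) k = fourierInt f k + fourierInt g k := by
  unfold fourierInt
  simp_rw [mul_add]
  rw [integral_add (integrable_expChar_mul hf _) (integrable_expChar_mul hg _), mul_add]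

theorem fourierInt_const_mul (c : ℂ) (f : ℝ → ℂ) (k : ℤ) :
    fourierInt (fun x => c * f x) k = c * fourierInt f k := by
  unfold fourierInt
  simp_rw [mul_left_comm _ c]
  rw [integral_const_mul, mul_left_comm]

theorem fourierInt_congr {f g : ℝ → ℂ} (h : f =ᵐ[periodMeasure] g) (k : ℤ) :
    fourierInt f k = fourierInt g k := by
  unfold fourierInt
  congr 1
  refine integral_congr_ae ?_
  filter_upwards [h] with x hx
  rw [hx]

theorem fourierInt_expChar_mul (j : ℤ) (f : ℝ → ℂ) (k : ℤ) :
    fourierInt (fun x => expChar j x * f x) k = fourierInt f (k - j) := by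
  unfold fourierInt
  congr 2
  ext x
  rw [← mul_assoc, ← expChar_add]
  congr 2
  ring

theorem fourierInt_conj (f : ℝ → ℂ) (k : ℤ) :
    fourierInt (fun x => (starRingEnd ℂ) (f x)) k = (starRingEnd ℂ) (fourierInt f (-k)) := by
  unfold fourierInt
  rw [map_mul, ← integral_conj]
  simp [conj_expChar, map_ofNat]

/-- Parseval's identity. -/
theorem hasSum_conj_mul_fourierInt {f g : ℝ → ℂ} (hf : MemLp f 2 periodMeasure)
    (hg : MemLp g 2 periodMeasure) :
    HasSum (fun k => (starRingEnd ℂ) (fourierInt f k) * fourierInt g k)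
      ((2 * π : ℂ)⁻¹ * ∫ x in Ioc (-π) π, (starRingEnd ℂ) (f x) * g x) := by
  have key : ∀ c : ℂ, HasSum (fun k => ((‖fourierInt f k + c * fourierInt g k‖ ^ 2 : ℝ) : ℂ))
      ((2 * π : ℂ)⁻¹ * ∫ x in Ioc (-π) π, ((‖f x + c * g x‖ ^ 2 : ℝ) : ℂ)) := by
    intro c
    have h := hasSum_sq_fourierInt (hf.add (hg.const_mul c))
    have h' := Complex.hasSum_ofReal.2 h
    have e : ∫ x in Ioc (-π) π, ((‖f x + c * g x‖ ^ 2 : ℝ) : ℂ)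
        = ((∫ x in Ioc (-π) π, ‖f x + c * g x‖ ^ 2 : ℝ) : ℂ) := integral_ofReal
    rw [e]
    convert h' using 1
    · ext k
      have := fourierInt_add hf.integrable_period (hg.const_mul c).integrable_period k
      rw [fourierInt_const_mul] at this
      rw [← this]
      rfl
    · push_cast
      rfl
  have hint : ∀ c : ℂ, Integrable (fun x => ((‖f x + c * g x‖ ^ 2 : ℝ) : ℂ)) periodMeasure := by
    intro c
    exact ((hf.add (hg.const_mul c)).integrable_norm_pow (by norm_num)).ofReal
  -- Complex polarization: the bilinear identity is a combination of four instances of the norm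
  -- identity `key`.
  have polar : ∀ z w : ℂ, (starRingEnd ℂ) z * w = (1 / 4 : ℂ) * ((‖z + 1 * w‖ ^ 2 : ℝ) : ℂ)
      + (-1 / 4) * ((‖z + (-1) * w‖ ^ 2 : ℝ) : ℂ)
      + (-Complex.I / 4) * ((‖z + Complex.I * w‖ ^ 2 : ℝ) : ℂ)
      + (Complex.I / 4) * ((‖z + (-Complex.I) * w‖ ^ 2 : ℝ) : ℂ) := by
    intro z w
    simp only [← Complex.normSq_eq_norm_sq]
    simp only [Complex.normSq_eq_conj_mul_self]
    simp only [map_add, map_mul, map_neg, map_one, Complex.conj_I]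
    ring_nf
    simp only [Complex.I_sq]
    ring
  have H := ((((key 1).mul_left (1 / 4 : ℂ)).add ((key (-1)).mul_left (-1 / 4 : ℂ))).add
    ((key Complex.I).mul_left (-Complex.I / 4 : ℂ))).add
    ((key (-Complex.I)).mul_left (Complex.I / 4 : ℂ))
  have e : (fun x => (starRingEnd ℂ) (f x) * g x) = _ := funext fun x => polar (f x) (g x)
  rw [e]
  have e' : (fun k => (starRingEnd ℂ) (fourierInt f k) * fourierInt g k) = _ :=
    funext fun k => polar (fourierInt f k) (fourierInt g k)
  rw [e', integral_add, integral_add, integral_add]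
  · simp only [integral_const_mul, mul_add, mul_left_comm (2 * π : ℂ)⁻¹]
    exact H
  all_goals
    first
      | exact (hint _).const_mul _
      | exact ((hint _).const_mul _).add ((hint _).const_mul _)
      | exact (((hint _).const_mul _).add ((hint _).const_mul _)).add ((hint _).const_mul _)

/-- Every square summable sequence is the sequence of Fourier coefficients of an `L²` function. -/
theorem exists_fourierInt_eq {c : ℤ → ℂ} (hc : Summable fun k => ‖c k‖ ^ 2) :
    ∃ f : ℝ → ℂ, MemLp f 2 periodMeasure ∧ ∀ k, fourierInt f k = c k := by
  have : Fact (0 < 2 * π) := ⟨by positivity⟩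
  have hc' : Memℓp c 2 := memℓp_gen (by simpa using hc)
  set F := (fourierBasis (T := 2 * π)).repr.symm ⟨c, hc'⟩ with hF
  have hmp := AddCircle.measurePreserving_mk (2 * π) (-π)
  have he : -π + 2 * π = π := by ring
  rw [he] at hmp
  refine ⟨fun x => F (x : AddCircle (2 * π)), ?_, fun k => ?_⟩
  · have h1 : MemLp (F : AddCircle (2 * π) → ℂ) 2 volume :=
      memLp_haarAddCircle_iff.1 (Lp.memLp F)
    exact h1.comp_measurePreserving hmp
  · have h1 := fourierBasis_repr F k
    rw [hF, LinearIsometryEquiv.apply_symm_apply, ← hF] at h1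
    rw [fourierCoeff_eq_intervalIntegral _ _ (-π), he,
      intervalIntegral.integral_of_le neg_pi_lt_pi.le] at h1
    have h2 : c k = _ := h1
    rw [h2, fourierInt]
    simp_rw [expChar_eq_fourier, smul_eq_mul]
    rw [Complex.real_smul]
    push_cast
    simp

/-! ### Fourier coefficients of real square integrable functions. -/

/-- The `k`-th Fourier coefficient of a real function in `L²(S¹)`. -/
noncomputable def coef (f : CircleL2) (k : ℤ) : ℂ := fourierInt (fun x => (f x : ℂ)) k

theorem memLp_ofReal_coe (f : CircleL2) : MemLp (fun x => (f x : ℂ)) 2 periodMeasure :=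
  (Lp.memLp f).ofReal

theorem coef_neg (f : CircleL2) (k : ℤ) : coef f (-k) = (starRingEnd ℂ) (coef f k) := by
  have := fourierInt_conj (fun x => (f x : ℂ)) (-k)
  simpa [coef] using this

theorem coef_add (f g : CircleL2) (k : ℤ) : coef (f + g) k = coef f k + coef g k := by
  rw [coef, coef, coef, ← fourierInt_add (memLp_ofReal_coe f).integrable_period
    (memLp_ofReal_coe g).integrable_period]
  refine fourierInt_congr ?_ k
  filter_upwards [Lp.coeFn_add f g] with x hx
  rw [hx]; simp

theorem coef_smul (c : ℝ) (f : CircleL2) (k : ℤ) : coef (c • f) k = c * coef f k := by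
  rw [coef, coef, ← fourierInt_const_mul]
  refine fourierInt_congr ?_ k
  filter_upwards [Lp.coeFn_smul c f] with x hx
  rw [hx]; simp

theorem coef_sub (f g : CircleL2) (k : ℤ) : coef (f - g) k = coef f k - coef g k := by
  have := coef_add f ((-1 : ℝ) • g) k
  rw [coef_smul] at this
  rw [sub_eq_add_neg, ← neg_one_smul ℝ g, this]
  push_cast; ring

/-- Parseval's identity for real functions. -/
theorem hasSum_conj_coef_mul_coef (f g : CircleL2) :
    HasSum (fun k => (starRingEnd ℂ) (coef f k) * coef g k)
      ((2 * π : ℂ)⁻¹ * (inner ℝ f g : ℝ)) := by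
  have h := hasSum_conj_mul_fourierInt (memLp_ofReal_coe f) (memLp_ofReal_coe g)
  convert h using 1
  congr 1
  rw [L2.inner_def]
  have e : ∫ x in Ioc (-π) π, (starRingEnd ℂ) (f x : ℂ) * (g x : ℂ)
      = ∫ x in Ioc (-π) π, ((f x * g x : ℝ) : ℂ) := by simp
  rw [e]
  have e' : ∫ x in Ioc (-π) π, ((f x * g x : ℝ) : ℂ)
      = ((∫ x in Ioc (-π) π, f x * g x : ℝ) : ℂ) := integral_ofReal
  rw [e']
  simp [mul_comm]

theorem hasSum_sq_coef (f : CircleL2) :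
    HasSum (fun k => ‖coef f k‖ ^ 2) ((2 * π)⁻¹ * ‖f‖ ^ 2) := by
  rw [← Complex.hasSum_ofReal]
  convert hasSum_conj_coef_mul_coef f f using 1
  · ext k
    rw [Complex.conj_mul']
    push_cast; rfl
  · rw [real_inner_self_eq_norm_sq]
    push_cast; rfl

theorem summable_sq_coef (f : CircleL2) : Summable fun k => ‖coef f k‖ ^ 2 :=
  (hasSum_sq_coef f).summable

theorem coef_injective {f g : CircleL2} (h : ∀ k, coef f k = coef g k) : f = g := by
  have h1 := hasSum_sq_coef (f - g)
  have h2 : (fun k => ‖coef (f - g) k‖ ^ 2) = fun _ => (0 : ℝ) := by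
    ext k; rw [coef_sub, h k]; simp
  rw [h2] at h1
  have h3 := h1.unique hasSum_zero
  have : ‖f - g‖ ^ 2 = 0 := by
    rcases mul_eq_zero.1 h3 with h | h
    · have := pi_pos; simp at h
    · exact h
  exact sub_eq_zero.1 (norm_eq_zero.1 (pow_eq_zero_iff (by norm_num) |>.1 this))

theorem exists_coef_eq {c : ℤ → ℂ} (hc : Summable fun k => ‖c k‖ ^ 2)
    (hr : ∀ k, c (-k) = (starRingEnd ℂ) (c k)) : ∃ f : CircleL2, ∀ k, coef f k = c k := by
  obtain ⟨F, hF, hFc⟩ := exists_fourierInt_eq hc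
  -- Conjugate symmetry of `c` makes `F` and its conjugate have the same coefficients, so passing to
  -- the real part changes none of them.
  have hre : MemLp (fun x => (F x).re) 2 periodMeasure := hF.re
  refine ⟨hre.toLp, fun k => ?_⟩
  have h1 : coef (hre.toLp) k
      = fourierInt (fun x => (1 / 2 : ℂ) * (F x + (starRingEnd ℂ) (F x))) k := by
    refine fourierInt_congr ?_ k
    filter_upwards [hre.coeFn_toLp] with x hx
    rw [hx, Complex.add_conj]; push_cast; ring
  have hconj : MemLp (fun x => (starRingEnd ℂ) (F x)) 2 periodMeasure := hF.star
  rw [h1, fourierInt_const_mul, fourierInt_add hF.integrable_period hconj.integrable_period,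
    fourierInt_conj, hFc, hFc, hr]
  simp; ring

/-! ### Weak derivatives and products on the Fourier side. -/

theorem integral_mul_eq_re_tsum (f : CircleL2) {φ : ℝ → ℝ} (hφ : Continuous φ) :
    ((∫ x in Ioc (-π) π, f x * φ x : ℝ) : ℂ)
      = 2 * π * ∑' k, (starRingEnd ℂ) (coef f k) * fourierInt (fun x => (φ x : ℂ)) k := by
  have hm : MemLp (fun x => (φ x : ℂ)) 2 periodMeasure := by
    obtain ⟨C, hC⟩ := (isCompact_Icc (a := -π) (b := π)).exists_bound_of_continuousOn
      hφ.continuousOn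
    refine MemLp.of_bound (Complex.continuous_ofReal.comp hφ).aestronglyMeasurable C ?_
    filter_upwards [ae_restrict_mem measurableSet_Ioc] with x hx
    simpa using hC x (Ioc_subset_Icc_self hx)
  have h := (hasSum_conj_mul_fourierInt (memLp_ofReal_coe f) hm).tsum_eq
  have : (π : ℂ) ≠ 0 := by exact_mod_cast pi_ne_zero
  unfold coef
  rw [h, ← mul_assoc, mul_inv_cancel₀ (by simp [this]), one_mul]
  have e' : ∫ x in Ioc (-π) π, ((f x * φ x : ℝ) : ℂ)
      = ((∫ x in Ioc (-π) π, f x * φ x : ℝ) : ℂ) := integral_ofReal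
  rw [← e']
  simp

theorem fourierInt_deriv_periodic {φ : ℝ → ℝ} (hφ : ContDiff ℝ 1 φ)
    (hp : Function.Periodic φ (2 * π)) (k : ℤ) :
    fourierInt (fun x => ((deriv φ x : ℝ) : ℂ)) k
      = Complex.I * k * fourierInt (fun x => (φ x : ℂ)) k := by
  have hd : ∀ x, HasDerivAt (fun x => (φ x : ℂ)) ((deriv φ x : ℝ) : ℂ) x := fun x =>
    ((hφ.differentiable (by norm_num)).differentiableAt.hasDerivAt).ofReal_comp
  have he : ∀ x, HasDerivAt (expChar (-k)) (-(Complex.I * k) * expChar (-k) x) x := by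
    intro x
    have h1 : HasDerivAt (fun x : ℝ => ((-k : ℤ) : ℂ) * x * Complex.I)
        (((-k : ℤ) : ℂ) * 1 * Complex.I) x :=
      ((Complex.ofRealCLM.hasDerivAt (x := x)).const_mul _).mul_const _
    have h2 := h1.cexp
    refine h2.congr_deriv ?_
    simp only [expChar]
    push_cast
    ring
  have hcd : Continuous (fun x => ((deriv φ x : ℝ) : ℂ)) :=
    Complex.continuous_ofReal.comp (hφ.continuous_deriv (by norm_num))
  have hi := intervalIntegral.integral_mul_deriv_eq_deriv_mul (a := -π) (b := π)
    (u := expChar (-k)) (v := fun x => (φ x : ℂ)) (u' := fun x => -(Complex.I * k) * expChar (-k) x)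
    (v' := fun x => ((deriv φ x : ℝ) : ℂ)) (fun x _ => he x) (fun x _ => hd x)
    ((continuous_const.mul (continuous_expChar _)).intervalIntegrable _ _)
    (hcd.intervalIntegrable _ _)
  have hb : expChar (-k) π * (φ π : ℂ) - expChar (-k) (-π) * (φ (-π) : ℂ) = 0 := by
    have h1 : φ π = φ (-π) := by
      have := hp (-π)
      rw [← this]; ring_nf
    have h2 : expChar (-k) π = expChar (-k) (-π) := by
      rw [expChar_eq_fourier, expChar_eq_fourier]
      congr 1
      rw [← AddCircle.coe_add_period (2 * π) (-π)]
      ring_nf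
    rw [h1, h2, sub_self]
  rw [hb, intervalIntegral.integral_of_le neg_pi_lt_pi.le,
    intervalIntegral.integral_of_le neg_pi_lt_pi.le] at hi
  unfold fourierInt
  rw [hi]
  simp_rw [mul_assoc]
  rw [integral_const_mul]
  ring

theorem hasWeakDeriv_of_coef {f g : CircleL2} (h : ∀ k : ℤ, coef g k = Complex.I * k * coef f k) :
    HasWeakDeriv f g := by
  intro φ hφ hp
  have h1 : ContDiff ℝ 1 φ := hφ.of_le (by norm_cast)
  have : ((∫ x in Ioc (-π) π, f x * deriv φ x : ℝ) : ℂ)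
      = ((- ∫ x in Ioc (-π) π, g x * φ x : ℝ) : ℂ) := by
    rw [Complex.ofReal_neg, integral_mul_eq_re_tsum f (h1.continuous_deriv (by norm_num)),
      integral_mul_eq_re_tsum g h1.continuous, ← mul_neg, ← tsum_neg]
    congr 1
    refine tsum_congr fun k => ?_
    rw [fourierInt_deriv_periodic h1 hp, h]
    simp
    ring
  exact_mod_cast this

theorem coef_eq_integral_cos_sin (f : CircleL2) (k : ℤ) :
    coef f k = (2 * π : ℂ)⁻¹ * (((∫ x in Ioc (-π) π, f x * Real.cos (k * x) : ℝ) : ℂ)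
      - Complex.I * ((∫ x in Ioc (-π) π, f x * Real.sin (k * x) : ℝ) : ℂ)) := by
  have hc : Continuous fun x : ℝ => Real.cos (k * x) := by fun_prop
  have hs : Continuous fun x : ℝ => Real.sin (k * x) := by fun_prop
  have e1 : ((∫ x in Ioc (-π) π, f x * Real.cos (k * x) : ℝ) : ℂ)
      = ∫ x in Ioc (-π) π, ((f x * Real.cos (k * x) : ℝ) : ℂ) := integral_ofReal.symm
  have e2 : ((∫ x in Ioc (-π) π, f x * Real.sin (k * x) : ℝ) : ℂ)
      = ∫ x in Ioc (-π) π, ((f x * Real.sin (k * x) : ℝ) : ℂ) := integral_ofReal.symm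
  rw [e1, e2, ← integral_const_mul, ← integral_sub, coef, fourierInt]
  · congr 2
    ext x
    have : expChar (-k) x = Complex.exp (((-(k * x) : ℝ) : ℂ) * Complex.I) := by
      rw [expChar]; push_cast; ring_nf
    rw [this, Complex.exp_mul_I, ← Complex.ofReal_cos, ← Complex.ofReal_sin, Real.cos_neg,
      Real.sin_neg]
    push_cast
    ring
  · exact (f.integrable_mul_continuous hc).ofReal
  · exact (f.integrable_mul_continuous hs).ofReal.const_mul _

theorem HasWeakDeriv.coef_eq {f g : CircleL2} (h : HasWeakDeriv f g) (k : ℤ) :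
    coef g k = Complex.I * k * coef f k := by
  have hper : ∀ x : ℝ, (k : ℝ) * (x + 2 * π) = k * x + k * (2 * π) := fun x => by ring
  -- Test functions are real, so the character is tested through its real and imaginary parts.
  have h1 := h (fun x => Real.cos (k * x)) (by fun_prop)
    (fun x => by simp only [hper, Real.cos_add_int_mul_two_pi])
  have h2 := h (fun x => Real.sin (k * x)) (by fun_prop)
    (fun x => by simp only [hper, Real.sin_add_int_mul_two_pi])
  have d1 : deriv (fun x : ℝ => Real.cos (k * x)) = fun x => -(k * Real.sin (k * x)) := by
    ext x
    have : HasDerivAt (fun x : ℝ => Real.cos (k * x)) (-Real.sin (k * x) * (k * 1)) x :=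
      ((hasDerivAt_id x).const_mul (k : ℝ)).cos
    rw [this.deriv]; ring
  have d2 : deriv (fun x : ℝ => Real.sin (k * x)) = fun x => k * Real.cos (k * x) := by
    ext x
    have : HasDerivAt (fun x : ℝ => Real.sin (k * x)) (Real.cos (k * x) * (k * 1)) x :=
      ((hasDerivAt_id x).const_mul (k : ℝ)).sin
    rw [this.deriv]; ring
  rw [d1] at h1
  rw [d2] at h2
  simp only [mul_neg, mul_left_comm _ (k : ℝ)] at h1 h2
  rw [integral_neg, integral_const_mul, neg_inj] at h1
  rw [integral_const_mul] at h2
  have h2' : ∫ x in Ioc (-π) π, g x * Real.sin (k * x)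
      = -(k * ∫ x in Ioc (-π) π, f x * Real.cos (k * x)) := by linarith
  rw [coef_eq_integral_cos_sin g, coef_eq_integral_cos_sin f, ← h1, h2']
  push_cast
  linear_combination ((2 * π : ℂ)⁻¹ * k * (∫ x in Ioc (-π) π, f x * Real.sin (k * x) : ℝ)) *
    Complex.I_sq

/-- The Fourier coefficients of a product are the convolution of the Fourier coefficients. -/
theorem hasSum_coef_mul (f g : CircleL2) (k : ℤ) :
    HasSum (fun j => coef f (k - j) * coef g j)
      (fourierInt (fun x => ((f x * g x : ℝ) : ℂ)) k) := by
  -- Parseval for `f` against `e^{-ikx} g`: `f` is real, so the conjugation disappears from the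
  -- integral, and the shift `j ↦ j - k` gives the convolution.
  have h := hasSum_conj_mul_fourierInt (memLp_ofReal_coe f)
    ((memLp_ofReal_coe g).mul_expChar (-k))
  simp_rw [fourierInt_expChar_mul] at h
  have e := (Equiv.subRight k).hasSum_iff (f := fun j => coef f (-j) * coef g (j + k))
    (a := fourierInt (fun x => ((f x * g x : ℝ) : ℂ)) k)
  have h' : HasSum (fun j => coef f (-j) * coef g (j + k))
      (fourierInt (fun x => ((f x * g x : ℝ) : ℂ)) k) := by
    convert h using 1
    · ext j
      rw [coef_neg, sub_neg_eq_add]; rfl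
    · rw [fourierInt]
      congr 2
      ext x
      simp
      ring
  convert e.2 h' using 1
  ext j
  simp

/-! ### Sobolev norms and summability of Fourier coefficients. -/

theorem weakDeriv_hasWeakDeriv {k : ℕ} (F : SobolevSpace k) (s : Fin k) :
    HasWeakDeriv (weakDeriv F s.castSucc) (weakDeriv F s.succ) := F.2 s

theorem norm_sq_sobolev {k : ℕ} (F : SobolevSpace k) :
    ‖F‖ ^ 2 = ∑ s, ‖weakDeriv F s‖ ^ 2 := by
  rw [Submodule.coe_norm, PiLp.norm_sq_eq_of_L2]
  rfl

theorem coef_weakDeriv {n : ℕ} (F : SobolevSpace n) (s : Fin (n + 1)) (k : ℤ) :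
    coef (weakDeriv F s) k = (Complex.I * k) ^ (s : ℕ) * coef (weakDeriv F 0) k := by
  induction s using Fin.induction with
  | zero => simp
  | succ i ih =>
    rw [(weakDeriv_hasWeakDeriv F i).coef_eq, ih, Fin.val_succ, Fin.val_castSucc, pow_succ]
    ring

theorem coef_weakDeriv_one (F : SobolevSpace 1) (k : ℤ) :
    coef (weakDeriv F 1) k = Complex.I * k * coef (weakDeriv F 0) k := by
  simpa using coef_weakDeriv F 1 k

theorem hasSum_sobolev_one (F : SobolevSpace 1) :
    HasSum (fun k : ℤ => (1 + (k : ℝ) ^ 2) * ‖coef (weakDeriv F 0) k‖ ^ 2)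
      ((2 * π)⁻¹ * ‖F‖ ^ 2) := by
  have h := (hasSum_sq_coef (weakDeriv F 0)).add (hasSum_sq_coef (weakDeriv F 1))
  convert h using 1
  · ext k
    rw [coef_weakDeriv_one, norm_mul, norm_mul, Complex.norm_I, Complex.norm_intCast, mul_pow,
      mul_pow, sq_abs]
    ring
  · rw [norm_sq_sobolev, Fin.sum_univ_two]; ring

/-- Termwise `bc ≤ b²/d + d c²` with `d = 1 + k²`. It serves twice: with `b = 1` for absolute
summability of the coefficients, and with a growing `b` for dominated convergence in the Hilbert
transform. -/
theorem summable_mul_coef_of_sobolev_one (F : SobolevSpace 1) {b : ℤ → ℝ} (hb : ∀ k, 0 ≤ b k)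
    (hs : Summable fun k : ℤ => b k ^ 2 / (1 + (k : ℝ) ^ 2)) :
    Summable (fun k => b k * ‖coef (weakDeriv F 0) k‖) ∧
    ∑' k, b k * ‖coef (weakDeriv F 0) k‖
      ≤ ∑' k : ℤ, b k ^ 2 / (1 + (k : ℝ) ^ 2) + ‖F‖ ^ 2 := by
  have h := hs.hasSum.add (hasSum_sobolev_one F)
  have hle : ∀ k : ℤ, b k * ‖coef (weakDeriv F 0) k‖ ≤ b k ^ 2 / (1 + (k : ℝ) ^ 2)
      + (1 + (k : ℝ) ^ 2) * ‖coef (weakDeriv F 0) k‖ ^ 2 := by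
    intro k
    set c := ‖coef (weakDeriv F 0) k‖
    have hd : 0 < 1 + (k : ℝ) ^ 2 := by positivity
    set d := 1 + (k : ℝ) ^ 2
    have : b k ^ 2 / d + d * c ^ 2 - b k * c = ((b k - d * c) ^ 2 + b k * d * c) / d := by
      field_simp; ring
    have h2 : 0 ≤ ((b k - d * c) ^ 2 + b k * d * c) / d := by
      have := hb k
      positivity
    linarith
  have hsum : Summable (fun k => b k * ‖coef (weakDeriv F 0) k‖) :=
    Summable.of_nonneg_of_le (fun k => mul_nonneg (hb k) (norm_nonneg _)) hle h.summable
  refine ⟨hsum, ?_⟩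
  have h3 := hsum.tsum_le_tsum hle h.summable
  rw [h.tsum_eq] at h3
  refine h3.trans (add_le_add le_rfl ?_)
  have : (2 * π)⁻¹ ≤ 1 := inv_le_one_of_one_le₀ (by linarith [pi_gt_three])
  nlinarith [sq_nonneg ‖F‖]

theorem summable_inv_one_add_sq : Summable fun k : ℤ => (1 : ℝ) ^ 2 / (1 + (k : ℝ) ^ 2) := by
  have h : Summable fun k : ℤ => 1 / (k : ℝ) ^ 2 := Real.summable_one_div_int_pow.2 (by norm_num)
  refine h.of_norm_bounded_eventually ?_
  filter_upwards [(Set.finite_singleton (0 : ℤ)).compl_mem_cofinite] with k hk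
  have hk' : (k : ℝ) ≠ 0 := by exact_mod_cast hk
  rw [Real.norm_of_nonneg (by positivity), one_pow]
  exact one_div_le_one_div_of_le (by positivity) (by linarith)

/-! ### Absolutely convergent Fourier series. -/

theorem integral_expChar (k : ℤ) (hk : k ≠ 0) : ∫ x in Ioc (-π) π, expChar k x = 0 := by
  have hc : (k : ℂ) * Complex.I ≠ 0 := mul_ne_zero (by exact_mod_cast hk) Complex.I_ne_zero
  have h := integral_exp_mul_complex (a := -π) (b := π) hc
  rw [← intervalIntegral.integral_of_le neg_pi_lt_pi.le]
  have e : ∀ x : ℝ, expChar k x = Complex.exp (k * Complex.I * x) := fun x => by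
    rw [expChar]; ring_nf
  have h2 : expChar k π = expChar k (-π) := by
    rw [expChar_eq_fourier, expChar_eq_fourier]
    congr 1
    rw [← AddCircle.coe_add_period (2 * π) (-π)]
    ring_nf
  rw [e, e] at h2
  simp_rw [e]
  rw [h, h2, sub_self, zero_div]

theorem fourierInt_expChar (j k : ℤ) : fourierInt (expChar j) k = if k = j then 1 else 0 := by
  have h := fourierInt_expChar_mul j (fun _ => 1) k
  simp only [mul_one] at h
  have hpi : (π : ℂ) ≠ 0 := by exact_mod_cast pi_ne_zero
  rw [show expChar j = fun x => expChar j x from rfl, h, fourierInt]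
  simp only [mul_one]
  split_ifs with hkj
  · have h2 : (2 * π : ℂ) ≠ 0 := by simp [hpi]
    simp [hkj, expChar_zero, pi_pos.le, ← two_mul]
    field_simp
  · rw [integral_expChar _ (by omega), mul_zero]

theorem fourierInt_tsum_expChar {c : ℤ → ℂ} (hc : Summable fun k => ‖c k‖) (k : ℤ) :
    fourierInt (fun x => ∑' j, c j * expChar j x) k = c k := by
  have hI : ∀ j, Integrable (fun x => expChar (-k) x * (c j * expChar j x)) periodMeasure := by
    intro j
    refine integrable_expChar_mul (Integrable.const_mul ?_ _) _
    have := integrable_expChar_mul (integrable_const (1 : ℂ) (μ := periodMeasure)) j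
    simpa using this
  have hn : ∀ j, ∫ x in Ioc (-π) π, ‖expChar (-k) x * (c j * expChar j x)‖
      = (2 * π) * ‖c j‖ := by
    intro j
    simp only [norm_mul, norm_expChar, one_mul, mul_one]
    simp [integral_const, two_mul, pi_pos.le]
  have h := hasSum_integral_of_summable_integral_norm hI (by simp_rw [hn]; exact hc.mul_left _)
  have h2 : HasSum (fun j => c j * fourierInt (expChar j) k)
      (fourierInt (fun x => ∑' j, c j * expChar j x) k) := by
    have e1 : ∀ j, c j * fourierInt (expChar j) k = (2 * π : ℂ)⁻¹ *
        ∫ x in Ioc (-π) π, expChar (-k) x * (c j * expChar j x) := by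
      intro j
      simp only [fourierInt]
      rw [mul_left_comm, ← integral_const_mul]
      congr 2; ext x; ring
    have e2 : fourierInt (fun x => ∑' j, c j * expChar j x) k = (2 * π : ℂ)⁻¹ *
        ∫ x in Ioc (-π) π, ∑' j, expChar (-k) x * (c j * expChar j x) := by
      simp only [fourierInt]
      congr 2; ext x
      rw [tsum_mul_left]
    simp only [e1, e2]
    exact h.mul_left _
  simp_rw [fourierInt_expChar] at h2
  have h3 := hasSum_ite_eq k (c k)
  refine h2.unique ?_
  convert h3 using 2 with j
  by_cases hj : j = k
  · simp [hj]
  · simp [hj, Ne.symm hj]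

/-! ### The principal value integral as the multiplier `-i sgn k`. -/

section Kernel

variable {x ε : ℝ}

/-- The domain of integration in the truncated Hilbert transform. -/
def truncSet (x ε : ℝ) : Set ℝ := {y : ℝ | y ∈ Ioc (-π) π ∧ ε < |x - y|}

/-- The condition `ε < π - |x|` keeps the excised interval inside the period, so nothing wraps
around and two intervals remain. -/
theorem truncSet_eq (hε : 0 < ε) (hx : ε < π - |x|) :
    truncSet x ε = Ioo (-π) (x - ε) ∪ Ioc (x + ε) π := by
  have h1 := le_abs_self x
  have h2 := neg_abs_le x
  ext y
  simp only [truncSet, mem_ofPred_eq, mem_union, mem_Ioc, mem_Ioo, lt_abs]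
  constructor
  · rintro ⟨⟨a, b⟩, h | h⟩
    · left; constructor <;> linarith
    · right; constructor <;> linarith
  · rintro (⟨a, b⟩ | ⟨a, b⟩)
    · exact ⟨⟨a, by linarith⟩, Or.inl (by linarith)⟩
    · exact ⟨⟨by linarith, b⟩, Or.inr (by linarith)⟩

theorem measurableSet_truncSet (x ε : ℝ) : MeasurableSet (truncSet x ε) :=
  measurableSet_Ioc.inter (measurableSet_lt measurable_const (measurable_const.sub measurable_id).abs)

theorem ne_of_mem_truncSet (hε : 0 < ε) {y : ℝ} (hy : y ∈ truncSet x ε) : y ≠ x := by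
  rintro rfl
  have := hy.2
  simp at this
  linarith

theorem truncSet_subset (x ε : ℝ) : truncSet x ε ⊆ Ioc (-π) π := fun _ h => h.1

theorem sin_half_ne_zero (hx : |x| < π) {y : ℝ} (hy : y ∈ Icc (-π) π) (hyx : y ≠ x) :
    Real.sin ((x - y) / 2) ≠ 0 := by
  have h1 := abs_lt.1 hx
  rcases lt_or_gt_of_ne hyx with h | h
  · exact (Real.sin_pos_of_pos_of_lt_pi (by linarith) (by linarith [hy.1])).ne'
  · exact (Real.sin_neg_of_neg_of_neg_pi_lt (by linarith) (by linarith [hy.2])).ne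

theorem continuousOn_expChar_sub (x : ℝ) (k : ℤ) (s : Set ℝ) :
    ContinuousOn (fun y => expChar k (y - x)) s :=
  ((continuous_expChar k).comp (continuous_id.sub continuous_const)).continuousOn

theorem integrableOn_truncSet (hε : 0 < ε) (hx : ε < π - |x|) {G : ℝ → ℂ}
    (hG : ContinuousOn G {y | y ∈ Icc (-π) π ∧ y ≠ x}) : IntegrableOn G (truncSet x ε) := by
  have h1 := le_abs_self x
  have h2 := neg_abs_le x
  rw [truncSet_eq hε hx, integrableOn_union]
  constructor
  · refine (ContinuousOn.integrableOn_Icc (a := -π) (b := x - ε) (hG.mono ?_)).mono_set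
      Ioo_subset_Icc_self
    intro y hy
    exact ⟨⟨hy.1, by linarith [hy.2]⟩, by rintro rfl; linarith [hy.2]⟩
  · refine (ContinuousOn.integrableOn_Icc (a := x + ε) (b := π) (hG.mono ?_)).mono_set
      Ioc_subset_Icc_self
    intro y hy
    exact ⟨⟨by linarith [hy.1], hy.2⟩, by rintro rfl; linarith [hy.1]⟩

theorem integral_truncSet (hε : 0 < ε) (hx : ε < π - |x|) {G Φ : ℝ → ℂ}
    (hG : ContinuousOn G {y | y ∈ Icc (-π) π ∧ y ≠ x})
    (hΦ : ∀ y ∈ Icc (-π) π, y ≠ x → HasDerivAt Φ (G y) y) :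
    ∫ y in truncSet x ε, G y = (Φ (x - ε) - Φ (-π)) + (Φ π - Φ (x + ε)) := by
  have h1 := le_abs_self x
  have h2 := neg_abs_le x
  have hi := integrableOn_truncSet hε hx hG
  have key : ∀ a b : ℝ, a ≤ b → Icc a b ⊆ {y | y ∈ Icc (-π) π ∧ y ≠ x} →
      ∫ y in Ioc a b, G y = Φ b - Φ a := by
    intro a b hab hs
    rw [← intervalIntegral.integral_of_le hab]
    refine intervalIntegral.integral_eq_sub_of_hasDerivAt ?_ ?_
    · intro y hy
      rw [uIcc_of_le hab] at hy
      exact hΦ y (hs hy).1 (hs hy).2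
    · exact (hG.mono (by rwa [uIcc_of_le hab])).intervalIntegrable
  rw [truncSet_eq hε hx] at hi ⊢
  rw [setIntegral_union _ measurableSet_Ioc (hi.mono_set subset_union_left)
    (hi.mono_set subset_union_right), ← integral_Ioc_eq_integral_Ioo, key, key]
  · linarith
  · intro y hy
    exact ⟨⟨by linarith [hy.1], hy.2⟩, by rintro rfl; linarith [hy.1]⟩
  · linarith
  · intro y hy
    exact ⟨⟨hy.1, by linarith [hy.2]⟩, by rintro rfl; linarith [hy.2]⟩
  · rw [Set.disjoint_left]
    intro y hy hy'
    linarith [hy.2, hy'.1]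

/-- The truncated Hilbert kernel tested against the characters. -/
noncomputable def truncKernel (x ε : ℝ) (k : ℤ) : ℂ :=
  ∫ y in truncSet x ε, expChar k (y - x) * (Real.cot ((x - y) / 2) : ℂ)

theorem continuousOn_cot (hx : |x| < π) :
    ContinuousOn (fun y => (Real.cot ((x - y) / 2) : ℂ)) {y | y ∈ Icc (-π) π ∧ y ≠ x} := by
  refine Complex.continuous_ofReal.comp_continuousOn ?_
  simp_rw [Real.cot_eq_cos_div_sin]
  refine ContinuousOn.div (by fun_prop) (by fun_prop) ?_
  intro y hy
  exact sin_half_ne_zero hx hy.1 hy.2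

theorem continuousOn_char_mul_cot (hx : |x| < π) (k : ℤ) :
    ContinuousOn (fun y => expChar k (y - x) * (Real.cot ((x - y) / 2) : ℂ))
      {y | y ∈ Icc (-π) π ∧ y ≠ x} := by
  refine ContinuousOn.mul ?_ (continuousOn_cot hx)
  exact continuousOn_expChar_sub x k _

theorem truncKernel_zero (hε : 0 < ε) (hx : ε < π - |x|) : truncKernel x ε 0 = 0 := by
  have hx' : |x| < π := by linarith
  unfold truncKernel
  -- `Real.log` is even, so one primitive serves on both sides of the singularity; its values at `x
  -- ± ε` cancel, and so do those at `±π`.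
  rw [integral_truncSet hε hx (Φ := fun y => ((-2 * Real.log (Real.sin ((x - y) / 2)) : ℝ) : ℂ))
    (continuousOn_char_mul_cot hx' 0)]
  · have e1 : (x - (x - ε)) / 2 = ε / 2 := by ring
    have e2 : (x - (x + ε)) / 2 = -(ε / 2) := by ring
    have e3 : (x - -π) / 2 = x / 2 + π / 2 := by ring
    have e4 : (x - π) / 2 = x / 2 - π / 2 := by ring
    rw [e1, e2, e3, e4, Real.sin_neg, Real.log_neg_eq_log, Real.sin_add_pi_div_two,
      Real.sin_sub_pi_div_two, Real.log_neg_eq_log]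
    ring
  · intro y hy hyx
    have hs := sin_half_ne_zero hx' hy hyx
    have h0 : HasDerivAt (fun y : ℝ => (x - y) / 2) (-1 / 2) y :=
      ((hasDerivAt_id y).const_sub x).div_const 2
    have h1 := ((h0.sin.log hs).const_mul (-2)).ofReal_comp
    refine h1.congr_deriv ?_
    rw [expChar_zero, one_mul, Real.cot_eq_cos_div_sin]
    push_cast
    ring

theorem truncKernel_neg (x ε : ℝ) (k : ℤ) :
    truncKernel x ε (-k) = (starRingEnd ℂ) (truncKernel x ε k) := by
  unfold truncKernel
  rw [← integral_conj]
  simp only [map_mul, conj_expChar, Complex.conj_ofReal]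

theorem integral_expChar_truncSet (hε : 0 < ε) (hx : ε < π - |x|) {k : ℤ} (hk : k ≠ 0) :
    ∫ y in truncSet x ε, expChar k (y - x)
      = (expChar k (-ε) - expChar k ε) / (k * Complex.I) := by
  have hc : (k : ℂ) * Complex.I ≠ 0 := mul_ne_zero (by exact_mod_cast hk) Complex.I_ne_zero
  rw [integral_truncSet hε hx (Φ := fun y => expChar k (y - x) / (k * Complex.I))
    (continuousOn_expChar_sub x k _)]
  · have h2 : expChar k (π - x) = expChar k (-π - x) := by
      rw [expChar_eq_fourier, expChar_eq_fourier]
      congr 1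
      rw [← AddCircle.coe_add_period (2 * π) (-π - x)]
      ring_nf
    rw [h2, sub_sub_cancel_left, add_sub_cancel_left]
    ring
  · intro y _ _
    have h1 : HasDerivAt (fun y : ℝ => (k : ℂ) * ((y - x : ℝ) : ℂ) * Complex.I)
        ((k : ℂ) * ((1 : ℝ) : ℂ) * Complex.I) y :=
      ((((hasDerivAt_id y).sub_const x).ofReal_comp).const_mul _).mul_const _
    refine (h1.cexp.div_const _).congr_deriv ?_
    rw [expChar]
    push_cast
    rw [mul_one, mul_div_assoc, div_self hc, mul_one]

theorem integral_expChar_zero_truncSet (hε : 0 < ε) (hx : ε < π - |x|) :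
    ∫ y in truncSet x ε, expChar 0 (y - x) = ((2 * π - 2 * ε : ℝ) : ℂ) := by
  rw [integral_truncSet hε hx (Φ := fun y => (y : ℂ))
    (continuousOn_expChar_sub x 0 _)]
  · push_cast; ring
  · intro y _ _
    rw [expChar_zero]
    exact (hasDerivAt_id y).ofReal_comp

/-- With `u = y - x`, `(e^{iu} - 1) cot(-u/2) = -i (e^{iu} + 1)`: consecutive kernels differ by
integrals without a singularity. -/
theorem truncKernel_succ (hε : 0 < ε) (hx : ε < π - |x|) (k : ℤ) :
    truncKernel x ε (k + 1) = truncKernel x ε k - Complex.I *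
      ((∫ y in truncSet x ε, expChar k (y - x)) + ∫ y in truncSet x ε, expChar (k + 1) (y - x)) := by
  have hx' : |x| < π := by linarith
  have hi : ∀ j : ℤ, IntegrableOn (fun y => expChar j (y - x)) (truncSet x ε) := fun j =>
    integrableOn_truncSet hε hx (continuousOn_expChar_sub x j _)
  have hk := integrableOn_truncSet hε hx (continuousOn_char_mul_cot hx' k)
  unfold truncKernel
  have h2 : IntegrableOn (fun y => Complex.I * (expChar k (y - x) + expChar (k + 1) (y - x)))
    (truncSet x ε) := ((hi k).add (hi (k + 1))).const_mul Complex.I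
  rw [← integral_add (hi k) (hi (k + 1)), ← integral_const_mul, ← integral_sub hk h2]
  refine setIntegral_congr_fun (measurableSet_truncSet x ε) ?_
  intro y hy
  have hs := sin_half_ne_zero hx' (Ioc_subset_Icc_self hy.1) (ne_of_mem_truncSet hε hy)
  have hs' : (Real.sin ((x - y) / 2) : ℂ) ≠ 0 := by exact_mod_cast hs
  simp only [expChar_add, Real.cot_eq_cos_div_sin]
  have e1 : expChar 1 (y - x)
      = (Real.cos ((x - y) / 2) - Real.sin ((x - y) / 2) * Complex.I) ^ 2 := by
    have : expChar 1 (y - x) = Complex.exp (((-((x - y) / 2) : ℝ) : ℂ) * Complex.I) ^ 2 := by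
      rw [expChar, ← Complex.exp_nat_mul]; congr 1; push_cast; ring
    rw [this, Complex.exp_mul_I, ← Complex.ofReal_cos, ← Complex.ofReal_sin, Real.cos_neg,
      Real.sin_neg]
    push_cast; ring
  have e2 : (Real.cos ((x - y) / 2) : ℂ) ^ 2 = 1 - (Real.sin ((x - y) / 2) : ℂ) ^ 2 := by
    have := Real.sin_sq_add_cos_sq ((x - y) / 2)
    have h : (Real.sin ((x - y) / 2) : ℂ) ^ 2 + (Real.cos ((x - y) / 2) : ℂ) ^ 2 = 1 := by
      exact_mod_cast this
    linear_combination h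
  have e3 : expChar 1 (y - x) = 1 - 2 * (Real.sin ((x - y) / 2) : ℂ) ^ 2
      - 2 * Real.cos ((x - y) / 2) * Real.sin ((x - y) / 2) * Complex.I := by
    rw [e1]
    linear_combination e2 + (Real.sin ((x - y) / 2) : ℂ) ^ 2 * Complex.I_sq
  rw [e3, Complex.ofReal_div]
  set s := (Real.sin ((x - y) / 2) : ℂ)
  set c := (Real.cos ((x - y) / 2) : ℂ)
  set e := expChar k (y - x)
  field_simp
  linear_combination (-2 * e * s * Complex.I) * e2 + (-2 * e * c * s ^ 2) * Complex.I_sq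

theorem norm_integral_expChar_truncSet_le (hε : 0 < ε) (hx : ε < π - |x|) {k : ℤ} (hk : k ≠ 0) :
    ‖∫ y in truncSet x ε, expChar k (y - x)‖ ≤ 2 / |(k : ℝ)| := by
  rw [integral_expChar_truncSet hε hx hk, norm_div, norm_mul, Complex.norm_I, mul_one,
    Complex.norm_intCast]
  gcongr
  calc ‖expChar k (-ε) - expChar k ε‖ ≤ ‖expChar k (-ε)‖ + ‖expChar k ε‖ := norm_sub_le _ _
    _ = 2 := by rw [norm_expChar, norm_expChar]; norm_num

/-- Telescoping `truncKernel_succ` from frequency `0`: the zero mode costs at most `2π`, and the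
integrals at frequency `j ≥ 1` at most `2/j` each, summed once up to `n` and once up to `n + 1`. -/
theorem norm_truncKernel_natCast_le (hε : 0 < ε) (hx : ε < π - |x|) (n : ℕ) :
    ‖truncKernel x ε (n + 1 : ℕ)‖ ≤ 2 * π + 2 * (harmonic n : ℝ) + 2 * (harmonic (n + 1) : ℝ) := by
  have hx0 := abs_nonneg x
  induction n with
  | zero =>
    have h := truncKernel_succ hε hx 0
    have h1 := norm_integral_expChar_truncSet_le hε hx (k := 1) one_ne_zero
    rw [truncKernel_zero hε hx, integral_expChar_zero_truncSet hε hx] at h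
    simp only [zero_add] at h
    simp only [zero_add, Nat.cast_one]
    rw [h, zero_sub, norm_neg, norm_mul, Complex.norm_I, one_mul]
    refine (norm_add_le _ _).trans ?_
    rw [Complex.norm_real, Real.norm_of_nonneg (by linarith)]
    norm_num [harmonic] at h1 ⊢
    linarith
  | succ n ih =>
    have h := truncKernel_succ hε hx (n + 1 : ℕ)
    have h1 := norm_integral_expChar_truncSet_le hε hx (k := (n + 1 : ℕ)) (by positivity)
    have h2 := norm_integral_expChar_truncSet_le hε hx (k := (n + 1 : ℕ) + 1) (by positivity)
    have e : (((n + 1 : ℕ) : ℤ) + 1) = ((n + 1 + 1 : ℕ) : ℤ) := by push_cast; ring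
    rw [e] at h h2
    rw [h]
    refine (norm_sub_le _ _).trans ?_
    rw [norm_mul, Complex.norm_I, one_mul]
    have h3 := norm_add_le (∫ y in truncSet x ε, expChar (n + 1 : ℕ) (y - x))
      (∫ y in truncSet x ε, expChar (n + 1 + 1 : ℕ) (y - x))
    have e1 : (harmonic (n + 1) : ℝ) = harmonic n + ((n + 1 : ℕ) : ℝ)⁻¹ := by
      rw [harmonic_succ]; push_cast; rfl
    have e2 : (harmonic (n + 1 + 1) : ℝ) = harmonic (n + 1) + ((n + 1 + 1 : ℕ) : ℝ)⁻¹ := by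
      rw [harmonic_succ]; push_cast; rfl
    rw [Int.cast_natCast, Nat.abs_cast, div_eq_mul_inv] at h1 h2
    linarith

/-- A summable majorant for the truncated Hilbert transforms of the characters. -/
theorem norm_truncKernel_le (hε : 0 < ε) (hx : ε < π - |x|) (k : ℤ) :
    ‖truncKernel x ε k‖ ≤ 40 * |(k : ℝ)| ^ (1 / 4 : ℝ) := by
  have hnat : ∀ n : ℕ, ‖truncKernel x ε n‖ ≤ 40 * (n : ℝ) ^ (1 / 4 : ℝ) := by
    intro n
    cases n with
    | zero =>
      rw [Nat.cast_zero, truncKernel_zero hε hx, norm_zero]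
      positivity
    | succ n =>
      have h := norm_truncKernel_natCast_le hε hx n
      have h1 : (harmonic n : ℝ) ≤ harmonic (n + 1) := by
        rw [harmonic_succ]; push_cast
        have : (0 : ℝ) ≤ ((n : ℝ) + 1)⁻¹ := by positivity
        linarith
      have h2 := harmonic_le_one_add_log (n + 1)
      have h3 := Real.log_le_rpow_div (x := ((n + 1 : ℕ) : ℝ)) (ε := 1 / 4) (by positivity)
        (by norm_num)
      have h4 : (1 : ℝ) ≤ ((n + 1 : ℕ) : ℝ) ^ (1 / 4 : ℝ) :=
        Real.one_le_rpow (by push_cast; linarith [n.cast_nonneg (α := ℝ)]) (by norm_num)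
      have h5 := pi_lt_four
      linarith
  obtain ⟨n, rfl | rfl⟩ := k.eq_nat_or_neg
  · simpa using hnat n
  · rw [truncKernel_neg, RCLike.norm_conj]
    simpa using hnat n

theorem eventually_small (hx : |x| < π) : ∀ᶠ ε in 𝓝[>] (0 : ℝ), 0 < ε ∧ ε < π - |x| :=
  Ioo_mem_nhdsGT (by linarith)

theorem tendsto_integral_expChar_truncSet (hx : |x| < π) {k : ℤ} (hk : k ≠ 0) :
    Tendsto (fun ε => ∫ y in truncSet x ε, expChar k (y - x)) (𝓝[>] 0) (𝓝 0) := by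
  have h : Tendsto (fun ε => (expChar k (-ε) - expChar k ε) / (k * Complex.I)) (𝓝[>] 0)
      (𝓝 ((expChar k (-0) - expChar k 0) / (k * Complex.I))) := by
    refine Tendsto.mono_left (Continuous.tendsto ?_ 0) nhdsWithin_le_nhds
    have := continuous_expChar k
    have h2 : Continuous fun ε : ℝ => expChar k (-ε) := this.comp continuous_neg
    exact (h2.sub this).div_const _
  rw [neg_zero, sub_self, zero_div] at h
  refine h.congr' ?_
  filter_upwards [eventually_small hx] with ε hε
  rw [integral_expChar_truncSet hε.1 hε.2 hk]

theorem tendsto_integral_expChar_zero_truncSet (hx : |x| < π) :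
    Tendsto (fun ε => ∫ y in truncSet x ε, expChar 0 (y - x)) (𝓝[>] 0) (𝓝 (2 * π)) := by
  have h : Tendsto (fun ε : ℝ => ((2 * π - 2 * ε : ℝ) : ℂ)) (𝓝[>] 0)
      (𝓝 ((2 * π - 2 * 0 : ℝ) : ℂ)) := by
    refine Tendsto.mono_left (Continuous.tendsto ?_ 0) nhdsWithin_le_nhds
    fun_prop
  rw [mul_zero, sub_zero] at h
  push_cast at h
  refine h.congr' ?_
  filter_upwards [eventually_small hx] with ε hε
  rw [integral_expChar_zero_truncSet hε.1 hε.2]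
  push_cast; rfl

/-- In the recursion only the zero mode survives as `ε → 0`, with limit `2π`. The limit thus jumps
by `-2πi` from frequency `0` to `1` and is constant afterwards; negative frequencies follow by
conjugation. -/
theorem tendsto_truncKernel (hx : |x| < π) (k : ℤ) :
    Tendsto (fun ε => truncKernel x ε k) (𝓝[>] 0)
      (𝓝 (-(2 * π) * Complex.I * (Int.sign k : ℂ))) := by
  have hsucc : ∀ (k : ℤ) {a b c : ℂ}, Tendsto (fun ε => truncKernel x ε k) (𝓝[>] 0) (𝓝 a) →
      Tendsto (fun ε => ∫ y in truncSet x ε, expChar k (y - x)) (𝓝[>] 0) (𝓝 b) →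
      Tendsto (fun ε => ∫ y in truncSet x ε, expChar (k + 1) (y - x)) (𝓝[>] 0) (𝓝 c) →
      Tendsto (fun ε => truncKernel x ε (k + 1)) (𝓝[>] 0) (𝓝 (a - Complex.I * (b + c))) := by
    intro k a b c ha hb hc
    refine (ha.sub ((hb.add hc).const_mul Complex.I)).congr' ?_
    filter_upwards [eventually_small hx] with ε hε
    rw [truncKernel_succ hε.1 hε.2]
  have hzero : Tendsto (fun ε => truncKernel x ε 0) (𝓝[>] 0) (𝓝 0) := by
    refine tendsto_const_nhds.congr' ?_
    filter_upwards [eventually_small hx] with ε hε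
    rw [truncKernel_zero hε.1 hε.2]
  have hnat : ∀ n : ℕ, Tendsto (fun ε => truncKernel x ε (n + 1 : ℕ)) (𝓝[>] 0)
      (𝓝 (-(2 * π) * Complex.I)) := by
    intro n
    induction n with
    | zero =>
      have h := hsucc 0 hzero (tendsto_integral_expChar_zero_truncSet hx)
        (tendsto_integral_expChar_truncSet hx (by norm_num))
      rw [show 0 - Complex.I * (2 * π + 0) = -(2 * π) * Complex.I by ring] at h
      exact h
    | succ n ih =>
      have h := hsucc _ ih (tendsto_integral_expChar_truncSet hx (by positivity))
        (tendsto_integral_expChar_truncSet hx (by positivity))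
      rw [add_zero, mul_zero, sub_zero] at h
      exact_mod_cast h
  obtain ⟨n, rfl | rfl⟩ := k.eq_nat_or_neg
  · cases n with
    | zero => simpa using hzero
    | succ n => simpa [Int.sign_natCast_of_ne_zero] using hnat n
  · cases n with
    | zero => simpa using hzero
    | succ n =>
      simp_rw [truncKernel_neg]
      have h := (Complex.continuous_conj.tendsto _).comp (hnat n)
      have e : (starRingEnd ℂ) (-(2 * π) * Complex.I)
          = -(2 * π) * Complex.I * (Int.sign (-(n + 1 : ℕ)) : ℂ) := by
        rw [Int.sign_neg, Int.sign_natCast_of_ne_zero (by positivity)]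
        simp [map_ofNat]
      rw [e] at h
      exact h

/-- The truncated Hilbert transform as a series. -/
theorem integral_mul_cot_truncSet (f : CircleL2) (hε : 0 < ε) (hx : ε < π - |x|) :
    HasSum (fun k => coef f k * expChar k x * truncKernel x ε k)
      ((∫ y in truncSet x ε, f y * Real.cot ((x - y) / 2) : ℝ) : ℂ) := by
  have hx' : |x| < π := by linarith [abs_nonneg x]
  set K : ℝ → ℂ := (truncSet x ε).indicator fun y => (Real.cot ((x - y) / 2) : ℂ) with hK
  have hKm : MemLp K 2 periodMeasure := by
    have h1 := le_abs_self x
    have h2 := neg_abs_le x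
    obtain ⟨C, hC⟩ := ((isCompact_Icc (a := -π) (b := x - ε)).union
      (isCompact_Icc (a := x + ε) (b := π))).exists_bound_of_continuousOn
      ((continuousOn_cot hx').mono (by
        rintro y (hy | hy)
        · exact ⟨⟨hy.1, by linarith [hy.2]⟩, by rintro rfl; linarith [hy.2]⟩
        · exact ⟨⟨by linarith [hy.1], hy.2⟩, by rintro rfl; linarith [hy.1]⟩))
    have hm : Measurable fun y => (Real.cot ((x - y) / 2) : ℂ) := by
      simp_rw [Real.cot_eq_cos_div_sin]
      fun_prop
    refine MemLp.of_bound (hm.indicator (measurableSet_truncSet x ε)).aestronglyMeasurable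
      (max C 0) (ae_of_all _ fun y => ?_)
    by_cases hy : y ∈ truncSet x ε
    · rw [hK, indicator_of_mem hy]
      rw [truncSet_eq hε hx] at hy
      exact (hC y (hy.imp (fun h => Ioo_subset_Icc_self h) fun h =>
        Ioc_subset_Icc_self h)).trans (le_max_left _ _)
    · rw [hK, indicator_of_notMem hy, norm_zero]
      exact le_max_right _ _
  -- Translating the character by `x` pulls out the phase `e^{ikx}` and leaves `truncKernel`.
  have hKc : ∀ k, (2 * π : ℂ) * fourierInt K (-k) = expChar k x * truncKernel x ε k := by
    intro k
    have hpi : (2 * π : ℂ) ≠ 0 := by simp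
    rw [fourierInt, ← mul_assoc, mul_inv_cancel₀ hpi, one_mul, truncKernel, ← integral_const_mul]
    have : ∀ y, expChar (-(-k)) y * K y = (truncSet x ε).indicator
        (fun y => expChar k x * (expChar k (y - x) * (Real.cot ((x - y) / 2) : ℂ))) y := by
      intro y
      by_cases hy : y ∈ truncSet x ε
      · rw [hK, indicator_of_mem hy, indicator_of_mem hy, neg_neg, ← mul_assoc]
        congr 1
        simp only [expChar, ← Complex.exp_add]
        congr 1; push_cast; ring
      · rw [hK, indicator_of_notMem hy, indicator_of_notMem hy, mul_zero]
    simp_rw [this]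
    rw [setIntegral_indicator (measurableSet_truncSet x ε),
      inter_eq_right.2 (truncSet_subset x ε)]
  have h := ((Equiv.neg ℤ).hasSum_iff.2
    (hasSum_conj_mul_fourierInt (memLp_ofReal_coe f) hKm)).mul_left (2 * π : ℂ)
  have hpi : (2 * π : ℂ) ≠ 0 := by simp
  rw [← mul_assoc, mul_inv_cancel₀ hpi, one_mul] at h
  have e1 : ∫ y in Ioc (-π) π, (starRingEnd ℂ) (f y : ℂ) * K y
      = ((∫ y in truncSet x ε, f y * Real.cot ((x - y) / 2) : ℝ) : ℂ) := by
    rw [← inter_eq_right.2 (truncSet_subset x ε),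
      ← setIntegral_indicator (measurableSet_truncSet x ε), ← integral_complex_ofReal]
    congr 1
    ext y
    by_cases hy : y ∈ truncSet x ε
    · rw [hK, indicator_of_mem hy, indicator_of_mem hy]; simp
    · rw [hK, indicator_of_notMem hy, indicator_of_notMem hy]; simp
  rw [e1] at h
  refine Eq.mp (congrArg (HasSum · _) (funext fun k => ?_)) h
  have e2 : fourierInt (fun x => (f x : ℂ)) (-k) = (starRingEnd ℂ) (coef f k) := coef_neg f k
  simp only [Function.comp, Equiv.neg_apply]
  rw [e2, Complex.conj_conj]
  linear_combination (coef f k) * hKc k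

end Kernel

/-- The kernels grow only logarithmically; any exponent below `1/2` would be summable here, since
the squared majorant over `k²` must decay faster than `1/|k|`. -/
theorem summable_majorant : Summable fun k : ℤ =>
    (40 * |(k : ℝ)| ^ (1 / 4 : ℝ)) ^ 2 / (1 + (k : ℝ) ^ 2) := by
  have h := (Real.summable_abs_int_rpow (b := 3 / 2) (by norm_num)).mul_left 1600
  refine Summable.of_nonneg_of_le (fun k => by positivity) (fun k => ?_) h
  rcases eq_or_ne k 0 with rfl | hk
  · norm_num
  · have hk' : 0 < |(k : ℝ)| := abs_pos.2 (by exact_mod_cast hk)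
    rw [div_le_iff₀ (by positivity), ← sq_abs (k : ℝ)]
    set r := |(k : ℝ)|
    have e1 : (r ^ (1 / 4 : ℝ)) ^ 2 = r ^ (1 / 2 : ℝ) := by
      rw [← Real.rpow_natCast, ← Real.rpow_mul hk'.le]; norm_num
    have e2 : r ^ (-(3 / 2) : ℝ) * r ^ 2 = r ^ (1 / 2 : ℝ) := by
      rw [← Real.rpow_natCast, ← Real.rpow_add hk']; norm_num
    have e3 : 0 ≤ r ^ (-(3 / 2) : ℝ) := by positivity
    rw [mul_pow, e1]
    nlinarith

theorem norm_sign_le_one (k : ℤ) : ‖((Int.sign k : ℤ) : ℂ)‖ ≤ 1 := by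
  rcases lt_trichotomy k 0 with h | h | h
  · simp [Int.sign_eq_neg_one_of_neg h]
  · simp [h]
  · simp [Int.sign_eq_one_of_pos h]

/-- For `f` in `H¹` the bound on `truncKernel`, uniform in `ε`, permits dominated convergence in the
series at every `|x| < π`. The limit is an absolutely convergent Fourier series, whose coefficients
can be read off. -/
theorem coef_of_isHilbertTransform (F : SobolevSpace 1) {g : CircleL2}
    (h : IsHilbertTransform (weakDeriv F 0) g) (k : ℤ) :
    coef g k = -Complex.I * (Int.sign k : ℂ) * coef (weakDeriv F 0) k := by
  set f := weakDeriv F 0 with hf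
  have hsum := (summable_mul_coef_of_sobolev_one F (b := fun _ => 1) (fun _ => zero_le_one)
    summable_inv_one_add_sq).1
  simp only [one_mul, ← hf] at hsum
  have hmaj := (summable_mul_coef_of_sobolev_one F (fun k => by positivity) summable_majorant).1
  rw [← hf] at hmaj
  set c : ℤ → ℂ := fun k => -Complex.I * (Int.sign k : ℂ) * coef f k with hc
  have hcs : Summable fun k => ‖c k‖ := by
    refine Summable.of_nonneg_of_le (fun _ => norm_nonneg _) (fun k => ?_) hsum
    rw [hc]
    simp only [norm_mul, norm_neg, Complex.norm_I, one_mul]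
    exact mul_le_of_le_one_left (norm_nonneg _) (norm_sign_le_one k)
  have key : (fun x => (g x : ℂ)) =ᵐ[periodMeasure] fun x => ∑' k, c k * expChar k x := by
    have hpi : ∀ᵐ x ∂periodMeasure, x ≠ π := by
      have : ({π} : Set ℝ)ᶜ ∈ ae (volume : Measure ℝ) := compl_mem_ae_iff.2 (measure_singleton _)
      filter_upwards [ae_restrict_of_ae this] with x hx using hx
    filter_upwards [h, hpi, ae_restrict_mem measurableSet_Ioc] with x hx hxpi hxI
    have hx' : |x| < π := abs_lt.2 ⟨hxI.1, lt_of_le_of_ne hxI.2 hxpi⟩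
    have h1 : Tendsto (fun ε => ((1 / (2 * π) *
        ∫ y in truncSet x ε, f y * Real.cot ((x - y) / 2) : ℝ) : ℂ)) (𝓝[>] 0) (𝓝 (g x : ℂ)) :=
      (Complex.continuous_ofReal.tendsto _).comp hx
    have h2 : Tendsto (fun ε => ∑' k, coef f k * expChar k x * truncKernel x ε k) (𝓝[>] 0)
        (𝓝 (∑' k, coef f k * expChar k x * (-(2 * π) * Complex.I * (Int.sign k : ℂ)))) := by
      refine tendsto_tsum_of_dominated_convergence hmaj ?_ ?_
      · intro k
        exact (tendsto_truncKernel hx' k).const_mul _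
      · filter_upwards [eventually_small hx'] with ε hε k
        rw [norm_mul, norm_mul, norm_expChar, mul_one, mul_comm]
        exact mul_le_mul_of_nonneg_right (norm_truncKernel_le hε.1 hε.2 k) (norm_nonneg _)
    have h3 := h2.const_mul ((2 * π : ℂ)⁻¹)
    have h4 : (fun ε => (2 * π : ℂ)⁻¹ * ∑' k, coef f k * expChar k x * truncKernel x ε k)
        =ᶠ[𝓝[>] 0] (fun ε => ((1 / (2 * π) *
        ∫ y in truncSet x ε, f y * Real.cot ((x - y) / 2) : ℝ) : ℂ)) := by
      filter_upwards [eventually_small hx'] with ε hε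
      rw [(integral_mul_cot_truncSet f hε.1 hε.2).tsum_eq]
      push_cast
      rw [one_div]
    have h5 := tendsto_nhds_unique h1 (h3.congr' h4)
    rw [h5, ← tsum_mul_left]
    refine tsum_congr fun k => ?_
    have hpi : (π : ℂ) ≠ 0 := by exact_mod_cast pi_ne_zero
    rw [hc]
    field_simp
  rw [coef, fourierInt_congr key, fourierInt_tsum_expChar hcs]

/-! ### The truncated weight and its inequalities, uniform in `N`. -/

/-- The truncated Sobolev weight `(1 + min(|k|, N))ⁿ`. -/
noncomputable def truncWeight (n N : ℕ) (k : ℤ) : ℝ := (1 + min |(k : ℝ)| N) ^ n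

theorem truncWeight_nonneg (n N : ℕ) (k : ℤ) : 0 ≤ truncWeight n N k := by
  unfold truncWeight; positivity

theorem truncWeight_neg (n N : ℕ) (k : ℤ) : truncWeight n N (-k) = truncWeight n N k := by
  unfold truncWeight; simp

theorem truncWeight_le (n N : ℕ) (k : ℤ) : truncWeight n N k ≤ (1 + N) ^ n := by
  unfold truncWeight
  gcongr
  exact min_le_right _ _

theorem truncWeight_le_weight (n N : ℕ) (k : ℤ) : truncWeight n N k ≤ (1 + |(k : ℝ)|) ^ n := by
  unfold truncWeight
  gcongr
  exact min_le_left _ _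

theorem truncWeight_eq (n : ℕ) {N : ℕ} {k : ℤ} (h : |(k : ℝ)| ≤ N) :
    truncWeight n N k = (1 + |(k : ℝ)|) ^ n := by
  rw [truncWeight, min_eq_left h]

/-- `min(|·|, N)` is subadditive, so the base at `k` is at most twice the larger of the bases at `j`
and `k - j`. -/
theorem truncWeight_le_add (n N : ℕ) (k j : ℤ) :
    truncWeight n N k ≤ 2 ^ n * (truncWeight n N j + truncWeight n N (k - j)) := by
  unfold truncWeight
  set y := 1 + min |(j : ℝ)| N
  set z := 1 + min |((k - j : ℤ) : ℝ)| N
  have hy : 0 ≤ y := by positivity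
  have hz : 0 ≤ z := by positivity
  have hk : |(k : ℝ)| ≤ |(j : ℝ)| + |((k - j : ℤ) : ℝ)| := by
    have := abs_add_le (j : ℝ) ((k - j : ℤ) : ℝ)
    push_cast at this ⊢
    simpa using this
  have hx : 1 + min |(k : ℝ)| N ≤ 2 * max y z := by
    have h1 : min |(k : ℝ)| N ≤ min |(j : ℝ)| N + min |((k - j : ℤ) : ℝ)| N := by
      have := abs_nonneg (j : ℝ)
      have := abs_nonneg ((k - j : ℤ) : ℝ)
      have := N.cast_nonneg (α := ℝ)
      rcases min_cases |(k : ℝ)| (N : ℝ) with h | h <;>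
      rcases min_cases |(j : ℝ)| (N : ℝ) with h' | h' <;>
      rcases min_cases |((k - j : ℤ) : ℝ)| (N : ℝ) with h'' | h'' <;> linarith
    have := le_max_left y z
    have := le_max_right y z
    linarith
  calc (1 + min |(k : ℝ)| N) ^ n ≤ (2 * max y z) ^ n := by gcongr
    _ = 2 ^ n * (max y z) ^ n := mul_pow _ _ _
    _ ≤ 2 ^ n * (y ^ n + z ^ n) := by
      gcongr
      rcases max_cases y z with h | h <;> rw [h.1] <;> linarith [pow_nonneg hy n, pow_nonneg hz n]

/-- A discrete mean value inequality: `uⁿ - wⁿ ≤ n (u - w) uⁿ⁻¹`, with the factor `s ≤ u` restoring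
the missing power. -/
theorem mul_pow_sub_pow_le {s u w d : ℝ} (hs : 0 ≤ s) (hsw : s ≤ w) (hwu : w ≤ u)
    (hd : u - w ≤ d) (n : ℕ) : s * (u ^ n - w ^ n) ≤ n * d * u ^ n := by
  have hw : 0 ≤ w := hs.trans hsw
  have hd0 : 0 ≤ d := (sub_nonneg.2 hwu).trans hd
  have hu : 0 ≤ u := hw.trans hwu
  induction n with
  | zero => simp
  | succ n ih =>
    have h1 : s * (u ^ (n + 1) - w ^ (n + 1)) = u * (s * (u ^ n - w ^ n)) + (u - w) * (s * w ^ n) := by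
      ring
    have h2 : (u - w) * (s * w ^ n) ≤ d * (u * u ^ n) := by
      have : w ^ n ≤ u ^ n := by gcongr
      have : s ≤ u := hsw.trans hwu
      gcongr
    have h3 := mul_le_mul_of_nonneg_left ih hu
    rw [h1]
    push_cast
    rw [pow_succ]
    nlinarith

/-- Split off `-v(j)² (k - j)`, which already carries the factor `k - j`; in the remainder `(v(k)² -
v(j)²) j` that factor comes from the difference of weights. -/
theorem truncWeight_commutator_aux (n N : ℕ) {k j : ℤ} (hjk : |(j : ℝ)| ≤ |(k : ℝ)|) :
    |truncWeight n N k ^ 2 * j - truncWeight n N j ^ 2 * k| ≤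
      (2 * n * 2 ^ n + 1) * |((k - j : ℤ) : ℝ)| * (truncWeight n N k * truncWeight n N j
        + truncWeight n N k * truncWeight n N (k - j)
        + truncWeight n N j * truncWeight n N (k - j)) := by
  have hv := truncWeight_le_add n N k j
  have h0k := truncWeight_nonneg n N k
  have h0j := truncWeight_nonneg n N j
  have h0d := truncWeight_nonneg n N (k - j)
  have hmono : truncWeight n N j ≤ truncWeight n N k := by
    unfold truncWeight
    gcongr
  have hd : |(k : ℝ)| - |(j : ℝ)| ≤ |((k - j : ℤ) : ℝ)| := by
    push_cast
    exact abs_sub_abs_le_abs_sub _ _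
  -- Below the cutoff this is the mean value inequality; if `|j| ≥ N` both weights are saturated and
  -- the difference vanishes. Hence no dependence on `N`.
  have key : |(j : ℝ)| * (truncWeight n N k - truncWeight n N j)
      ≤ n * |((k - j : ℤ) : ℝ)| * truncWeight n N k := by
    rcases le_total |(j : ℝ)| N with h | h
    · unfold truncWeight
      refine mul_pow_sub_pow_le (abs_nonneg _) ?_ ?_ ?_ n
      · rw [min_eq_left h]; linarith
      · gcongr
      · rw [min_eq_left h]
        linarith [min_le_left |(k : ℝ)| (N : ℝ)]
    · have : truncWeight n N k = truncWeight n N j := by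
        unfold truncWeight
        rw [min_eq_right h, min_eq_right (h.trans hjk)]
      rw [this, sub_self, mul_zero]
      positivity
  set vk := truncWeight n N k
  set vj := truncWeight n N j
  set vd := truncWeight n N (k - j)
  have e : vk ^ 2 * j - vj ^ 2 * k = -(vj ^ 2 * ((k - j : ℤ) : ℝ)) + (vk ^ 2 - vj ^ 2) * j := by
    push_cast; ring
  rw [e]
  refine (abs_add_le _ _).trans ?_
  rw [abs_neg, abs_mul, abs_mul, abs_of_nonneg (sq_nonneg vj),
    abs_of_nonneg (by nlinarith : 0 ≤ vk ^ 2 - vj ^ 2)]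
  set d := |((k - j : ℤ) : ℝ)|
  have hd0 : 0 ≤ d := abs_nonneg _
  have h1 : vj ^ 2 * d ≤ d * (vk * vj) := by
    have : vj ^ 2 ≤ vk * vj := by nlinarith
    nlinarith
  have h2 : (vk ^ 2 - vj ^ 2) * |(j : ℝ)| ≤ 2 * n * 2 ^ n * d * (vk * vj + vk * vd) := by
    calc (vk ^ 2 - vj ^ 2) * |(j : ℝ)| = (vk + vj) * (|(j : ℝ)| * (vk - vj)) := by ring
      _ ≤ (vk + vj) * (n * d * vk) := by gcongr
      -- One of the two factors `v(k)` is spent through `truncWeight_le_add`, so that the result is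
      -- a sum of products of weights at distinct frequencies.
      _ ≤ (2 * vk) * (n * d * (2 ^ n * (vj + vd))) := by gcongr; linarith
      _ = _ := by ring
  have h3 : 0 ≤ 2 * n * 2 ^ n * d * (vj * vd) := by positivity
  have h4 : 0 ≤ d * (vk * vd + vj * vd) := by positivity
  nlinarith

theorem truncWeight_commutator (n N : ℕ) (k j : ℤ) :
    |truncWeight n N k ^ 2 * j - truncWeight n N j ^ 2 * k| ≤
      (2 * n * 2 ^ n + 1) * |((k - j : ℤ) : ℝ)| * (truncWeight n N k * truncWeight n N j
        + truncWeight n N k * truncWeight n N (k - j)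
        + truncWeight n N j * truncWeight n N (k - j)) := by
  rcases le_total |(j : ℝ)| |(k : ℝ)| with h | h
  · exact truncWeight_commutator_aux n N h
  · have h1 := truncWeight_commutator_aux n N h
    have e : truncWeight n N (j - k) = truncWeight n N (k - j) := by
      rw [← truncWeight_neg, neg_sub]
    have e2 : |((j - k : ℤ) : ℝ)| = |((k - j : ℤ) : ℝ)| := by
      rw [← abs_neg]; push_cast; rw [neg_sub]
    rw [e, e2, abs_sub_comm] at h1
    refine h1.trans (le_of_eq ?_)
    ring

/-! ### Trilinear estimates for the stretching and transport terms. -/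

section Convolution

theorem hasSum_mul_prod {a b : ℤ → ℝ} (ha : ∀ k, 0 ≤ a k) (hb : ∀ k, 0 ≤ b k)
    (hsa : Summable a) (hsb : Summable b) :
    HasSum (fun p : ℤ × ℤ => a p.1 * b p.2) ((∑' k, a k) * ∑' k, b k) :=
  hsa.hasSum.mul hsb.hasSum (hsa.mul_of_nonneg hsb ha hb)

/-- The change of variables `(k, j) ↦ (k - j, j)`. -/
def subSndEquiv : ℤ × ℤ ≃ ℤ × ℤ where
  toFun p := (p.1 - p.2, p.2)
  invFun p := (p.1 + p.2, p.2)
  left_inv p := by simp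
  right_inv p := by simp

/-- The change of variables `(k, j) ↦ (k - j, k)`. -/
def subFstEquiv : ℤ × ℤ ≃ ℤ × ℤ where
  toFun p := (p.1 - p.2, p.1)
  invFun p := (p.2, p.2 - p.1)
  left_inv p := by simp
  right_inv p := by simp

theorem hasSum_sub_snd {a b : ℤ → ℝ} (ha : ∀ k, 0 ≤ a k) (hb : ∀ k, 0 ≤ b k)
    (hsa : Summable a) (hsb : Summable b) :
    HasSum (fun p : ℤ × ℤ => a (p.1 - p.2) * b p.2) ((∑' k, a k) * ∑' k, b k) :=
  subSndEquiv.hasSum_iff.2 (hasSum_mul_prod ha hb hsa hsb)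

theorem hasSum_sub_fst {a b : ℤ → ℝ} (ha : ∀ k, 0 ≤ a k) (hb : ∀ k, 0 ≤ b k)
    (hsa : Summable a) (hsb : Summable b) :
    HasSum (fun p : ℤ × ℤ => a (p.1 - p.2) * b p.1) ((∑' k, a k) * ∑' k, b k) :=
  subFstEquiv.hasSum_iff.2 (hasSum_mul_prod ha hb hsa hsb)

/-- The trilinear majorant of the energy estimate. -/
noncomputable def energyMajorant (v : ℤ → ℝ) (X Y : ℤ → ℂ) (p : ℤ × ℤ) : ℝ :=
  ‖X p.1‖ * ‖Y (p.1 - p.2)‖ * ‖X p.2‖ *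
    (v p.1 * v p.2 + v p.1 * v (p.1 - p.2) + v p.2 * v (p.1 - p.2))

theorem energyMajorant_nonneg {v : ℤ → ℝ} (hv : ∀ k, 0 ≤ v k) (X Y : ℤ → ℂ) (p : ℤ × ℤ) :
    0 ≤ energyMajorant v X Y p := by
  have := hv p.1; have := hv p.2; have := hv (p.1 - p.2)
  unfold energyMajorant; positivity

/-- In each of the three products the two weighted factors are separated by `ab ≤ (a² + b²)/2`; the
unweighted factor is summed in `ℓ¹`. This gives six convolution sums, each factoring after a change
of variables. -/
theorem energyMajorant_bound {v : ℤ → ℝ} (hv : ∀ k, 0 ≤ v k) {X Y : ℤ → ℂ}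
    (hX : Summable fun k => ‖X k‖) (hY : Summable fun k => ‖Y k‖)
    (hvX : Summable fun k => (v k * ‖X k‖) ^ 2) (hvY : Summable fun k => (v k * ‖Y k‖) ^ 2) :
    Summable (energyMajorant v X Y) ∧
    ∑' p, energyMajorant v X Y p ≤ (∑' k, ‖X k‖ + ∑' k, ‖Y k‖) *
      (∑' k, (v k * ‖X k‖) ^ 2 + ∑' k, (v k * ‖Y k‖) ^ 2) := by
  have nX : ∀ k, 0 ≤ ‖X k‖ := fun k => norm_nonneg _
  have nY : ∀ k, 0 ≤ ‖Y k‖ := fun k => norm_nonneg _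
  have sX : ∀ k, 0 ≤ (v k * ‖X k‖) ^ 2 := fun k => sq_nonneg _
  have sY : ∀ k, 0 ≤ (v k * ‖Y k‖) ^ 2 := fun k => sq_nonneg _
  have H := ((((((hasSum_sub_fst nY sX hY hvX).add (hasSum_sub_snd nY sX hY hvX)).add
    (hasSum_mul_prod sX nX hvX hX)).add (hasSum_sub_snd sY nX hvY hX)).add
    (hasSum_mul_prod nX sX hX hvX)).add (hasSum_sub_fst sY nX hvY hX)).mul_left (1 / 2)
  have hle : ∀ p, energyMajorant v X Y p ≤ _ := fun p => by
    refine le_trans ?_ (le_refl ((1 / 2 : ℝ) * (‖Y (p.1 - p.2)‖ * (v p.1 * ‖X p.1‖) ^ 2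
      + ‖Y (p.1 - p.2)‖ * (v p.2 * ‖X p.2‖) ^ 2
      + (v p.1 * ‖X p.1‖) ^ 2 * ‖X p.2‖ + (v (p.1 - p.2) * ‖Y (p.1 - p.2)‖) ^ 2 * ‖X p.2‖
      + ‖X p.1‖ * (v p.2 * ‖X p.2‖) ^ 2 + (v (p.1 - p.2) * ‖Y (p.1 - p.2)‖) ^ 2 * ‖X p.1‖)))
    unfold energyMajorant
    have h1 := mul_nonneg (nY (p.1 - p.2)) (sq_nonneg (v p.1 * ‖X p.1‖ - v p.2 * ‖X p.2‖))
    have h2 := mul_nonneg (nX p.2)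
      (sq_nonneg (v p.1 * ‖X p.1‖ - v (p.1 - p.2) * ‖Y (p.1 - p.2)‖))
    have h3 := mul_nonneg (nX p.1)
      (sq_nonneg (v p.2 * ‖X p.2‖ - v (p.1 - p.2) * ‖Y (p.1 - p.2)‖))
    linarith
  have hs : Summable (energyMajorant v X Y) :=
    Summable.of_nonneg_of_le (energyMajorant_nonneg hv X Y) hle H.summable
  refine ⟨hs, ?_⟩
  have h := hs.tsum_le_tsum hle H.summable
  rw [H.tsum_eq] at h
  refine h.trans ?_
  have t1 : 0 ≤ ∑' k, ‖Y k‖ := tsum_nonneg nY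
  have t2 : 0 ≤ ∑' k, (v k * ‖Y k‖) ^ 2 := tsum_nonneg sY
  have t3 := mul_nonneg t1 t2
  linarith

/-- The nonlinear stretching term in the energy identity. -/
theorem stretching_bound {v : ℤ → ℝ} (hv : ∀ k, 0 ≤ v k) {c : ℝ} (hc : 0 ≤ c)
    (h1 : ∀ k j, v k ≤ c * (v j + v (k - j)))
    {X Y Z T : ℤ → ℂ} (hZ : ∀ k, ‖Z k‖ ≤ ‖X k‖)
    (hs : Summable (energyMajorant v X Y))
    (hT : ∀ k, HasSum (fun j => Y (k - j) * Z j) (T k)) :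
    (Summable fun k => (v k : ℂ) ^ 2 * (starRingEnd ℂ) (X k) * T k) ∧
    |(∑' k, (v k : ℂ) ^ 2 * (starRingEnd ℂ) (X k) * T k).re|
      ≤ c * ∑' p, energyMajorant v X Y p := by
  set F : ℤ × ℤ → ℂ := fun p =>
    (v p.1 : ℂ) ^ 2 * (starRingEnd ℂ) (X p.1) * (Y (p.1 - p.2) * Z p.2) with hF
  have hFle : ∀ p, ‖F p‖ ≤ c * energyMajorant v X Y p := by
    intro p
    have a1 := hv p.1; have a2 := hv p.2; have a3 := hv (p.1 - p.2)
    simp only [hF, norm_mul, norm_pow, Complex.norm_real, RCLike.norm_conj,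
      Real.norm_of_nonneg a1]
    calc v p.1 ^ 2 * ‖X p.1‖ * (‖Y (p.1 - p.2)‖ * ‖Z p.2‖)
        = v p.1 * (v p.1 * ‖X p.1‖ * (‖Y (p.1 - p.2)‖ * ‖Z p.2‖)) := by ring
      -- Only one of the two factors `v(k)` is distributed over the convolution.
      _ ≤ (c * (v p.2 + v (p.1 - p.2))) * (v p.1 * ‖X p.1‖ * (‖Y (p.1 - p.2)‖ * ‖X p.2‖)) := by
        gcongr
        · exact h1 _ _
        · exact hZ _
      _ = c * (‖X p.1‖ * ‖Y (p.1 - p.2)‖ * ‖X p.2‖ * (v p.1 * v p.2 + v p.1 * v (p.1 - p.2))) := by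
        ring
      _ ≤ c * energyMajorant v X Y p := by
        unfold energyMajorant
        have h5 : 0 ≤ c * (‖X p.1‖ * ‖Y (p.1 - p.2)‖ * ‖X p.2‖ * (v p.2 * v (p.1 - p.2))) := by
          positivity
        linarith
  have hFs : Summable F := Summable.of_norm_bounded (hs.mul_left c) hFle
  have hFk : ∀ k, HasSum (fun j => F (k, j)) ((v k : ℂ) ^ 2 * (starRingEnd ℂ) (X k) * T k) :=
    fun k => by
      simp only [hF]
      exact (hT k).mul_left ((v k : ℂ) ^ 2 * (starRingEnd ℂ) (X k))
  have h2 := HasSum.prod_fiberwise hFs.hasSum hFk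
  refine ⟨h2.summable, ?_⟩
  rw [h2.tsum_eq]
  have h3 : ‖∑' p, F p‖ ≤ ∑' p, c * energyMajorant v X Y p :=
    tsum_of_norm_bounded (hs.mul_left c).hasSum hFle
  rw [tsum_mul_left] at h3
  have h4 := Complex.abs_re_le_norm (∑' p, F p)
  exact h4.trans h3

/-- The transport term in the energy identity: symmetrization gains the derivative back. -/
theorem transport_bound {v : ℤ → ℝ} (hv : ∀ k, 0 ≤ v k) {B : ℝ} (hB : ∀ k, v k ≤ B)
    {c : ℝ} (hc : 0 ≤ c)
    (h2 : ∀ k j : ℤ, |v k ^ 2 * j - v j ^ 2 * k| ≤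
      c * |((k - j : ℤ) : ℝ)| * (v k * v j + v k * v (k - j) + v j * v (k - j)))
    {X Y M T : ℤ → ℂ} (hM : ∀ k : ℤ, |(k : ℝ)| * ‖M k‖ ≤ ‖Y k‖)
    (hMr : ∀ k, M (-k) = (starRingEnd ℂ) (M k)) (hMs : Summable fun k => ‖M k‖)
    (hX2 : Summable fun k => ‖X k‖ ^ 2) (hX3 : Summable fun k : ℤ => (|(k : ℝ)| * ‖X k‖) ^ 2)
    (hs : Summable (energyMajorant v X Y))
    (hT : ∀ k, HasSum (fun j : ℤ => M (k - j) * (Complex.I * j * X j)) (T k)) :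
    (Summable fun k => (v k : ℂ) ^ 2 * (starRingEnd ℂ) (X k) * T k) ∧
    |(∑' k, (v k : ℂ) ^ 2 * (starRingEnd ℂ) (X k) * T k).re|
      ≤ c * ∑' p, energyMajorant v X Y p := by
  set F : ℤ × ℤ → ℂ := fun p =>
    (v p.1 : ℂ) ^ 2 * (starRingEnd ℂ) (X p.1) * (M (p.1 - p.2) * (Complex.I * p.2 * X p.2)) with hF
  have nM : ∀ k, 0 ≤ ‖M k‖ := fun k => norm_nonneg _
  -- Absolute convergence is needed to exchange `k` and `j`. It uses `v ≤ B` and the `H¹` regularity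
  -- of `X`; `B` does not enter the final estimate.
  have hFs : Summable F := by
    have H := ((hasSum_sub_fst nM (fun k => sq_nonneg ‖X k‖) hMs hX2).add
      (hasSum_sub_snd nM (fun k => sq_nonneg (|(k : ℝ)| * ‖X k‖)) hMs hX3)).mul_left (B ^ 2)
    refine Summable.of_norm_bounded H.summable fun p => ?_
    simp only [hF, norm_mul, norm_pow, Complex.norm_real, RCLike.norm_conj,
      Real.norm_of_nonneg (hv p.1), Complex.norm_I, one_mul, Complex.norm_intCast]
    calc v p.1 ^ 2 * ‖X p.1‖ * (‖M (p.1 - p.2)‖ * (|(p.2 : ℝ)| * ‖X p.2‖))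
        = v p.1 ^ 2 * (‖M (p.1 - p.2)‖ * (‖X p.1‖ * (|(p.2 : ℝ)| * ‖X p.2‖))) := by ring
      _ ≤ B ^ 2 * (‖M (p.1 - p.2)‖ * (‖X p.1‖ ^ 2 + (|(p.2 : ℝ)| * ‖X p.2‖) ^ 2)) := by
        have h3 := hv p.1
        have h4 := hB p.1
        have h5 : 0 ≤ ‖X p.1‖ * (|(p.2 : ℝ)| * ‖X p.2‖) := by positivity
        have h6 := sq_nonneg (‖X p.1‖ - (|(p.2 : ℝ)| * ‖X p.2‖))
        gcongr
        linarith
      _ = _ := by ring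
  have hFk : ∀ k, HasSum (fun j => F (k, j)) ((v k : ℂ) ^ 2 * (starRingEnd ℂ) (X k) * T k) :=
    fun k => by
      simp only [hF]
      exact (hT k).mul_left ((v k : ℂ) ^ 2 * (starRingEnd ℂ) (X k))
  have h3 := HasSum.prod_fiberwise hFs.hasSum hFk
  have h4 : HasSum (fun p : ℤ × ℤ => F p.swap) (∑' p, F p) :=
    (Equiv.hasSum_iff (f := F) (Equiv.prodComm ℤ ℤ)).2 hFs.hasSum
  have h5 := (Complex.hasSum_re (hFs.hasSum.add h4)).mul_left (1 / 2)
  have h6 : 1 / 2 * (∑' p, F p + ∑' p, F p).re = (∑' p, F p).re := by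
    rw [Complex.add_re]; ring
  rw [h6] at h5
  refine ⟨h3.summable, ?_⟩
  rw [h3.tsum_eq, ← h5.tsum_eq, ← tsum_mul_left, ← Real.norm_eq_abs]
  refine tsum_of_norm_bounded (hs.mul_left c).hasSum fun p => ?_
  -- Conjugating the swapped term leaves its real part unchanged, and reality of `M` gives both
  -- terms the common factor `M (k - j)`; only the commutator of the weights remains.
  have e : (F p + F p.swap).re = (((v p.1 ^ 2 * p.2 - v p.2 ^ 2 * p.1 : ℝ) : ℂ) *
      (Complex.I * (starRingEnd ℂ) (X p.1) * M (p.1 - p.2) * X p.2)).re := by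
    rw [Complex.add_re, ← Complex.conj_re (F p.swap), ← Complex.add_re]
    congr 1
    have hm : (starRingEnd ℂ) (M (p.2 - p.1)) = M (p.1 - p.2) := by
      rw [← hMr, neg_sub]
    simp only [hF, Prod.fst_swap, Prod.snd_swap, map_mul, map_pow, Complex.conj_ofReal,
      Complex.conj_conj, hm, Complex.conj_I, map_intCast]
    push_cast
    ring
  rw [e, Real.norm_eq_abs, abs_mul]
  have h7 := Complex.abs_re_le_norm (((v p.1 ^ 2 * p.2 - v p.2 ^ 2 * p.1 : ℝ) : ℂ) *
      (Complex.I * (starRingEnd ℂ) (X p.1) * M (p.1 - p.2) * X p.2))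
  rw [norm_mul, norm_mul, norm_mul, norm_mul, Complex.norm_I, one_mul, RCLike.norm_conj,
    Complex.norm_real, Real.norm_eq_abs] at h7
  have h8 := h2 p.1 p.2
  have a1 := hv p.1; have a2 := hv p.2; have a3 := hv (p.1 - p.2)
  have h9 : |v p.1 ^ 2 * p.2 - v p.2 ^ 2 * p.1| * (‖X p.1‖ * ‖M (p.1 - p.2)‖ * ‖X p.2‖)
      ≤ c * energyMajorant v X Y p := by
    calc _ ≤ c * |((p.1 - p.2 : ℤ) : ℝ)| * (v p.1 * v p.2 + v p.1 * v (p.1 - p.2)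
          + v p.2 * v (p.1 - p.2)) * (‖X p.1‖ * ‖M (p.1 - p.2)‖ * ‖X p.2‖) := by gcongr
      _ = c * (‖X p.1‖ * (|((p.1 - p.2 : ℤ) : ℝ)| * ‖M (p.1 - p.2)‖) * ‖X p.2‖ *
          (v p.1 * v p.2 + v p.1 * v (p.1 - p.2) + v p.2 * v (p.1 - p.2))) := by ring
      _ ≤ c * energyMajorant v X Y p := by
        unfold energyMajorant
        gcongr
        exact hM _
  have h10 := abs_nonneg (((v p.1 ^ 2 * p.2 - v p.2 ^ 2 * p.1 : ℝ) : ℂ) *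
      (Complex.I * (starRingEnd ℂ) (X p.1) * M (p.1 - p.2) * X p.2)).re
  rw [abs_of_nonneg (by norm_num : (0 : ℝ) ≤ 1 / 2)]
  linarith

end Convolution

/-! ### Fourier multipliers and the energy estimate at a fixed time. -/

theorem norm_sq_eq_tsum_coef (f : CircleL2) : ‖f‖ ^ 2 = 2 * π * ∑' k, ‖coef f k‖ ^ 2 := by
  rw [(hasSum_sq_coef f).tsum_eq, ← mul_assoc, mul_inv_cancel₀ (by positivity), one_mul]

theorem summable_weighted_coef {v : ℤ → ℝ} (hv : ∀ k, 0 ≤ v k) {B : ℝ} (hB : ∀ k, v k ≤ B)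
    (f : CircleL2) : Summable fun k => (v k * ‖coef f k‖) ^ 2 := by
  refine Summable.of_nonneg_of_le (fun _ => sq_nonneg _) (fun k => ?_)
    ((summable_sq_coef f).mul_left (B ^ 2))
  rw [mul_pow]
  have := hv k
  have := hB k
  gcongr

/-- Fourier multipliers with a bounded, even, real symbol act on `L²(S¹)`. -/
theorem exists_multiplier {v : ℤ → ℝ} (hv : ∀ k, 0 ≤ v k) {B : ℝ} (hB : ∀ k, v k ≤ B)
    (he : ∀ k, v (-k) = v k) :
    ∃ A : CircleL2 →L[ℝ] CircleL2, ∀ f k, coef (A f) k = v k * coef f k := by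
  have hex : ∀ f : CircleL2, ∃ g : CircleL2, ∀ k, coef g k = v k * coef f k := by
    intro f
    refine exists_coef_eq ?_ ?_
    · refine (summable_weighted_coef hv hB f).congr fun k => ?_
      rw [norm_mul, Complex.norm_real, Real.norm_of_nonneg (hv k)]
    · intro k
      rw [he, coef_neg, map_mul, Complex.conj_ofReal]
  choose A hA using hex
  let L : CircleL2 →ₗ[ℝ] CircleL2 :=
    { toFun := A
      map_add' := fun f g => coef_injective fun k => by
        rw [hA, coef_add, coef_add, hA, hA]; ring
      map_smul' := fun c f => coef_injective fun k => by
        rw [hA, coef_smul, RingHom.id_apply, coef_smul, hA]; ring }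
  have hB0 : 0 ≤ B := (hv 0).trans (hB 0)
  refine ⟨L.mkContinuous B fun f => ?_, fun f k => hA f k⟩
  refine le_of_sq_le_sq ?_ (by positivity)
  rw [mul_pow, norm_sq_eq_tsum_coef, norm_sq_eq_tsum_coef f, mul_left_comm]
  have hle : ∀ k, ‖coef (L f) k‖ ^ 2 ≤ B ^ 2 * ‖coef f k‖ ^ 2 := by
    intro k
    have : coef (L f) k = v k * coef f k := hA f k
    rw [this, norm_mul, Complex.norm_real, Real.norm_of_nonneg (hv k), mul_pow]
    have := hv k
    have := hB k
    gcongr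
  have h := (summable_sq_coef (L f)).tsum_le_tsum hle ((summable_sq_coef f).mul_left _)
  rw [tsum_mul_left] at h
  exact mul_le_mul_of_nonneg_left h (by positivity)

theorem norm_sq_multiplier {v : ℤ → ℝ} (hv : ∀ k, 0 ≤ v k) {A : CircleL2 →L[ℝ] CircleL2}
    (hA : ∀ f k, coef (A f) k = v k * coef f k) (f : CircleL2) :
    ‖A f‖ ^ 2 = 2 * π * ∑' k, (v k * ‖coef f k‖) ^ 2 := by
  rw [norm_sq_eq_tsum_coef]
  congr 1
  refine tsum_congr fun k => ?_
  rw [hA, norm_mul, Complex.norm_real, Real.norm_of_nonneg (hv k)]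

theorem inner_multiplier {v : ℤ → ℝ} {A : CircleL2 →L[ℝ] CircleL2}
    (hA : ∀ f k, coef (A f) k = v k * coef f k) (f g : CircleL2) :
    inner ℝ (A f) (A g)
      = 2 * π * (∑' k, (v k : ℂ) ^ 2 * (starRingEnd ℂ) (coef f k) * coef g k).re := by
  have h := (hasSum_conj_coef_mul_coef (A f) (A g)).tsum_eq
  have e : ∑' k, (starRingEnd ℂ) (coef (A f) k) * coef (A g) k
      = ∑' k, (v k : ℂ) ^ 2 * (starRingEnd ℂ) (coef f k) * coef g k := by
    refine tsum_congr fun k => ?_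
    rw [hA, hA, map_mul, Complex.conj_ofReal]; ring
  rw [e] at h
  rw [h]
  have e2 : (2 * π : ℂ)⁻¹ * ((inner ℝ (A f) (A g) : ℝ) : ℂ)
      = (((2 * π)⁻¹ * inner ℝ (A f) (A g) : ℝ) : ℂ) := by push_cast; rfl
  rw [e2, Complex.ofReal_re, ← mul_assoc, mul_inv_cancel₀ (by positivity), one_mul]

theorem summable_norm_coef (F : SobolevSpace 1) : Summable fun k => ‖coef (weakDeriv F 0) k‖ := by
  simpa only [one_mul] using (summable_mul_coef_of_sobolev_one F (b := fun _ => 1)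
    (fun _ => zero_le_one) summable_inv_one_add_sq).1

theorem tsum_norm_coef_le (F : SobolevSpace 1) : ∑' k, ‖coef (weakDeriv F 0) k‖
    ≤ ∑' k : ℤ, (1 : ℝ) ^ 2 / (1 + (k : ℝ) ^ 2) + ‖F‖ ^ 2 := by
  simpa only [one_mul] using (summable_mul_coef_of_sobolev_one F (b := fun _ => 1)
    (fun _ => zero_le_one) summable_inv_one_add_sq).2

theorem coef_of_equation {a : ℝ} {u f g h k' : CircleL2}
    (heq : ∀ᵐ x ∂(volume.restrict (Ioc (-π) π)), u x + a * f x * g x - h x * k' x = 0) (k : ℤ) :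
    coef u k = -a * fourierInt (fun x => ((f x * g x : ℝ) : ℂ)) k
      + fourierInt (fun x => ((h x * k' x : ℝ) : ℂ)) k := by
  have hi : ∀ f g : CircleL2, Integrable (fun x => ((f x * g x : ℝ) : ℂ)) periodMeasure :=
    fun f g => ((Lp.memLp f).integrable_mul (Lp.memLp g)).ofReal
  rw [← fourierInt_const_mul, ← fourierInt_add ((hi f g).const_mul _) (hi h k'), coef]
  refine fourierInt_congr ?_ k
  filter_upwards [heq] with x hx
  have : u x = -a * (f x * g x) + h x * k' x := by linarith
  rw [this]
  push_cast
  ring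

/-- The weighted energy estimate for one of the two equations, at a fixed time. -/
theorem energy_rate_bound {v : ℤ → ℝ} (hv : ∀ k, 0 ≤ v k) {B : ℝ} (hB : ∀ k, v k ≤ B)
    {c : ℝ} (hc : 0 ≤ c) (h1 : ∀ k j, v k ≤ c * (v j + v (k - j)))
    (h2 : ∀ k j : ℤ, |v k ^ 2 * j - v j ^ 2 * k| ≤
      c * |((k - j : ℤ) : ℝ)| * (v k * v j + v k * v (k - j) + v j * v (k - j)))
    {a : ℝ} {F G P M : SobolevSpace 1} (hP : IsVelocityOf F P) (hM : IsVelocityOf G M)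
    {u : CircleL2}
    (heq : ∀ᵐ x ∂(volume.restrict (Ioc (-π) π)),
      u x + a * weakDeriv M 0 x * weakDeriv F 1 x - weakDeriv G 0 x * weakDeriv P 1 x = 0) :
    |(∑' k, (v k : ℂ) ^ 2 * (starRingEnd ℂ) (coef (weakDeriv F 0) k) * coef u k).re|
      ≤ (|a| + 1) * (c * ((∑' k, ‖coef (weakDeriv F 0) k‖ + ∑' k, ‖coef (weakDeriv G 0) k‖) *
      (∑' k, (v k * ‖coef (weakDeriv F 0) k‖) ^ 2
        + ∑' k, (v k * ‖coef (weakDeriv G 0) k‖) ^ 2))) := by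
  set X := coef (weakDeriv F 0) with hX
  set Y := coef (weakDeriv G 0) with hY
  obtain ⟨hs, hsle⟩ := energyMajorant_bound hv (summable_norm_coef F) (summable_norm_coef G)
    (summable_weighted_coef hv hB (weakDeriv F 0)) (summable_weighted_coef hv hB (weakDeriv G 0))
  rw [← hX, ← hY] at hs hsle
  have hHP := coef_of_isHilbertTransform F hP.1
  have hHM := coef_of_isHilbertTransform G hM.1
  -- The gain of one derivative: `M' = H G` and the Hilbert symbol has modulus at most one.
  have hMY : ∀ k : ℤ, |(k : ℝ)| * ‖coef (weakDeriv M 0) k‖ ≤ ‖Y k‖ := by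
    intro k
    have h := congrArg norm ((coef_weakDeriv_one M k).symm.trans (hHM k))
    rw [norm_mul, norm_mul, norm_mul, norm_mul, norm_neg, Complex.norm_I, one_mul, one_mul,
      Complex.norm_intCast] at h
    rw [h]
    exact mul_le_of_le_one_left (norm_nonneg _) (norm_sign_le_one k)
  have hX3 : Summable fun k : ℤ => (|(k : ℝ)| * ‖X k‖) ^ 2 := by
    refine (summable_sq_coef (weakDeriv F 1)).congr fun k => ?_
    rw [coef_weakDeriv_one, norm_mul, norm_mul, Complex.norm_I, one_mul, Complex.norm_intCast]
  have hT1 := fun k => hasSum_coef_mul (weakDeriv M 0) (weakDeriv F 1) k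
  simp only [coef_weakDeriv_one] at hT1
  have hT2 := fun k => hasSum_coef_mul (weakDeriv G 0) (weakDeriv P 1) k
  obtain ⟨b1, b2⟩ := transport_bound hv hB hc h2 hMY (coef_neg _) (summable_norm_coef M)
    (summable_sq_coef _) hX3 hs hT1
  obtain ⟨d1, d2⟩ := stretching_bound hv hc h1 (Z := coef (weakDeriv P 1)) (fun k => by
    rw [hHP, norm_mul, norm_mul, norm_neg, Complex.norm_I, one_mul]
    exact mul_le_of_le_one_left (norm_nonneg _) (norm_sign_le_one k)) hs hT2
  have e : ∑' k, (v k : ℂ) ^ 2 * (starRingEnd ℂ) (X k) * coef u k = (-a : ℂ) * (∑' k,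
      (v k : ℂ) ^ 2 * (starRingEnd ℂ) (X k) *
        fourierInt (fun x => ((weakDeriv M 0 x * weakDeriv F 1 x : ℝ) : ℂ)) k)
      + ∑' k, (v k : ℂ) ^ 2 * (starRingEnd ℂ) (X k) *
        fourierInt (fun x => ((weakDeriv G 0 x * weakDeriv P 1 x : ℝ) : ℂ)) k := by
    rw [← tsum_mul_left, ← (b1.mul_left _).tsum_add d1]
    refine tsum_congr fun k => ?_
    rw [coef_of_equation heq]
    ring
  rw [e, Complex.add_re]
  refine (abs_add_le _ _).trans ?_
  rw [← Complex.ofReal_neg, Complex.re_ofReal_mul, abs_mul, abs_neg]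
  have h3 := mul_le_mul_of_nonneg_left hsle hc
  have h4 := mul_le_mul_of_nonneg_left (b2.trans h3) (abs_nonneg a)
  rw [add_mul, one_mul]
  exact add_le_add h4 (d2.trans h3)

/-! ### Sobolev regularity from weighted coefficients. -/

theorem summable_weight_coef_of_sobolev {n : ℕ} (F : SobolevSpace n) :
    Summable fun k : ℤ => ((1 + |(k : ℝ)|) ^ n * ‖coef (weakDeriv F 0) k‖) ^ 2 := by
  refine Summable.of_nonneg_of_le (fun _ => sq_nonneg _) (fun k => ?_)
    (((summable_sq_coef (weakDeriv F 0)).add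
      (summable_sq_coef (weakDeriv F (Fin.last n)))).mul_left ((2 ^ n) ^ 2))
  rw [coef_weakDeriv F (Fin.last n), norm_mul, norm_pow, norm_mul, Complex.norm_I, one_mul,
    Complex.norm_intCast, Fin.val_last]
  set r := |(k : ℝ)|
  have hr : 0 ≤ r := abs_nonneg _
  have h : ((1 + r) ^ n) ^ 2 ≤ (2 ^ n) ^ 2 * (1 + (r ^ n) ^ 2) := by
    rcases le_total r 1 with h | h
    · have : (1 + r) ^ n ≤ 2 ^ n := by gcongr; linarith
      have h2 : ((1 + r) ^ n) ^ 2 ≤ (2 ^ n) ^ 2 := by gcongr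
      have : 0 ≤ ((2 : ℝ) ^ n) ^ 2 * (r ^ n) ^ 2 := by positivity
      linarith
    · have : (1 + r) ^ n ≤ (2 * r) ^ n := by gcongr; linarith
      have h2 : ((1 + r) ^ n) ^ 2 ≤ ((2 * r) ^ n) ^ 2 := by gcongr
      rw [mul_pow, mul_pow] at h2
      have : 0 ≤ ((2 : ℝ) ^ n) ^ 2 := by positivity
      linarith
  rw [mul_pow, mul_pow]
  calc _ ≤ (2 ^ n) ^ 2 * (1 + (r ^ n) ^ 2) * ‖coef (weakDeriv F 0) k‖ ^ 2 := by gcongr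
    _ = _ := by ring

/-- A function whose weighted Fourier coefficients are square summable lies in `Hⁿ(S¹)`. -/
theorem exists_sobolev_of_sum_le {n : ℕ} {f : CircleL2} {B : ℝ}
    (hB : ∀ s : Finset ℤ, ∑ k ∈ s, ((1 + |(k : ℝ)|) ^ n * ‖coef f k‖) ^ 2 ≤ B) :
    ∃ U : SobolevSpace n, weakDeriv U 0 = f ∧ ‖U‖ ^ 2 ≤ (n + 1) * (2 * π * B) := by
  have hs : Summable fun k : ℤ => ((1 + |(k : ℝ)|) ^ n * ‖coef f k‖) ^ 2 :=
    summable_of_sum_le (fun _ => sq_nonneg _) hB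
  have hle : ∀ (s : Fin (n + 1)) (k : ℤ), ‖(Complex.I * k) ^ (s : ℕ) * coef f k‖ ^ 2
      ≤ ((1 + |(k : ℝ)|) ^ n * ‖coef f k‖) ^ 2 := by
    intro s k
    rw [norm_mul, norm_pow, norm_mul, Complex.norm_I, one_mul, Complex.norm_intCast]
    have h0 := abs_nonneg (k : ℝ)
    have : |(k : ℝ)| ^ (s : ℕ) ≤ (1 + |(k : ℝ)|) ^ n :=
      calc |(k : ℝ)| ^ (s : ℕ) ≤ (1 + |(k : ℝ)|) ^ (s : ℕ) := by gcongr; linarith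
        _ ≤ (1 + |(k : ℝ)|) ^ n := pow_le_pow_right₀ (by linarith) (by omega)
    gcongr
  have hex : ∀ s : Fin (n + 1), ∃ g : CircleL2, ∀ k : ℤ,
      coef g k = (Complex.I * k) ^ (s : ℕ) * coef f k := by
    intro s
    refine exists_coef_eq (Summable.of_nonneg_of_le (fun _ => sq_nonneg _) (hle s) hs) ?_
    intro k
    rw [coef_neg, map_mul, map_pow, map_mul, Complex.conj_I, map_intCast]
    congr 2
    push_cast
    ring
  choose g hg using hex
  have hw : ∀ s : Fin n, HasWeakDeriv (g s.castSucc) (g s.succ) := by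
    intro s
    refine hasWeakDeriv_of_coef fun k => ?_
    rw [hg, hg, Fin.val_succ, Fin.val_castSucc, pow_succ]
    ring
  refine ⟨⟨WithLp.toLp 2 g, hw⟩, ?_, ?_⟩
  · refine coef_injective fun k => ?_
    change coef (g 0) k = _
    rw [hg]; simp
  · rw [norm_sq_sobolev]
    have : ∀ s : Fin (n + 1), ‖weakDeriv (⟨WithLp.toLp 2 g, hw⟩ : SobolevSpace n) s‖ ^ 2
        ≤ 2 * π * B := by
      intro s
      change ‖g s‖ ^ 2 ≤ _
      rw [norm_sq_eq_tsum_coef]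
      simp only [hg]
      gcongr
      exact ((Summable.of_nonneg_of_le (fun _ => sq_nonneg _) (hle s) hs).tsum_le_tsum
        (hle s) hs).trans (hs.tsum_le_of_sum_le hB)
    refine (Finset.sum_le_sum fun s _ => this s).trans ?_
    simp

/-! ### Grönwall's inequality and propagation of the weighted energy. -/

/-- `E(s) e^{-Ks}` is nonincreasing; the one-sided derivative is a genuine one on the open interval,
and continuity covers the endpoints. -/
theorem le_mul_exp_of_deriv_le {T K : ℝ} {E E' : ℝ → ℝ}
    (hE : ∀ t ∈ Ico 0 T, HasDerivWithinAt E (E' t) (Ico 0 T) t) {t : ℝ} (ht : t ∈ Ico 0 T)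
    (hK : ∀ τ ∈ Icc 0 t, E' τ ≤ K * E τ) : E t ≤ E 0 * Real.exp (K * t) := by
  have hsub : Icc 0 t ⊆ Ico 0 T := fun τ hτ => ⟨hτ.1, hτ.2.trans_lt ht.2⟩
  have hexp : ∀ τ : ℝ, HasDerivAt (fun s => Real.exp (-K * s)) (Real.exp (-K * τ) * (-K * 1)) τ :=
    fun τ => ((hasDerivAt_id τ).const_mul (-K)).exp
  have hd : ∀ τ ∈ Ioo 0 t, HasDerivAt (fun s => E s * Real.exp (-K * s))
      (E' τ * Real.exp (-K * τ) + E τ * (Real.exp (-K * τ) * (-K * 1))) τ := fun τ hτ =>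
    ((hE τ (hsub (Ioo_subset_Icc_self hτ))).hasDerivAt
      (Ico_mem_nhds hτ.1 (hτ.2.trans ht.2))).mul (hexp τ)
  have hanti : AntitoneOn (fun s => E s * Real.exp (-K * s)) (Icc 0 t) := by
    refine antitoneOn_of_deriv_nonpos (convex_Icc 0 t) ?_ ?_ ?_
    · intro τ hτ
      exact ((hE τ (hsub hτ)).continuousWithinAt.mono hsub).mul
        (hexp τ).continuousAt.continuousWithinAt
    · rw [interior_Icc]
      exact fun τ hτ => (hd τ hτ).differentiableAt.differentiableWithinAt
    · rw [interior_Icc]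
      intro τ hτ
      rw [(hd τ hτ).deriv]
      have h1 := hK τ (Ioo_subset_Icc_self hτ)
      have h2 := mul_nonneg (sub_nonneg.2 h1) (Real.exp_pos (-K * τ)).le
      linarith
  have h := hanti (left_mem_Icc.2 ht.1) (right_mem_Icc.2 ht.1) ht.1
  simp only [mul_zero, Real.exp_zero, mul_one] at h
  calc E t = (E t * Real.exp (-K * t)) * Real.exp (K * t) := by
        rw [mul_assoc, ← Real.exp_add]; simp
    _ ≤ E 0 * Real.exp (K * t) := by gcongr

/-- Propagation of the weighted energy, with a constant that depends on the weight only through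
its structural constant `c`. -/
theorem weighted_energy_le {a T : ℝ} {Ω ω p m : ℝ → SobolevSpace 1}
    (hsol : IsMHDSolution a T Ω ω p m)
    {v : ℤ → ℝ} (hv : ∀ k, 0 ≤ v k) {B : ℝ} (hB : ∀ k, v k ≤ B) (he : ∀ k, v (-k) = v k)
    {c : ℝ} (hc : 0 ≤ c) (h1 : ∀ k j, v k ≤ c * (v j + v (k - j)))
    (h2 : ∀ k j : ℤ, |v k ^ 2 * j - v j ^ 2 * k| ≤
      c * |((k - j : ℤ) : ℝ)| * (v k * v j + v k * v (k - j) + v j * v (k - j)))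
    {R : ℝ} {t : ℝ} (ht : t ∈ Ico 0 T)
    (hR : ∀ τ ∈ Icc 0 t, ∑' k, ‖coef (weakDeriv (Ω τ) 0) k‖
      + ∑' k, ‖coef (weakDeriv (ω τ) 0) k‖ ≤ R) :
    ∑' k, (v k * ‖coef (weakDeriv (Ω t) 0) k‖) ^ 2 + ∑' k, (v k * ‖coef (weakDeriv (ω t) 0) k‖) ^ 2
      ≤ (∑' k, (v k * ‖coef (weakDeriv (Ω 0) 0) k‖) ^ 2
        + ∑' k, (v k * ‖coef (weakDeriv (ω 0) 0) k‖) ^ 2)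
        * Real.exp (4 * (|a| + 1) * c * R * t) := by
  obtain ⟨A, hA⟩ := exists_multiplier hv hB he
  choose! Ω' hΩ' hΩe using hsol.eq_Ω
  choose! ω' hω' hωe using hsol.eq_ω
  set En : ℝ → ℝ := fun τ => ∑' k, (v k * ‖coef (weakDeriv (Ω τ) 0) k‖) ^ 2
    + ∑' k, (v k * ‖coef (weakDeriv (ω τ) 0) k‖) ^ 2 with hEn
  have hEA : ∀ τ, ‖A (weakDeriv (Ω τ) 0)‖ ^ 2 + ‖A (weakDeriv (ω τ) 0)‖ ^ 2
      = 2 * π * En τ := fun τ => by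
    rw [norm_sq_multiplier hv hA, norm_sq_multiplier hv hA, hEn]; ring
  -- `A` is bounded on `L²`, so the `L²` time derivatives suffice to differentiate the weighted
  -- energy.
  have hder : ∀ τ ∈ Ico 0 T, HasDerivWithinAt
      (fun s => ‖A (weakDeriv (Ω s) 0)‖ ^ 2 + ‖A (weakDeriv (ω s) 0)‖ ^ 2)
      (2 * inner ℝ (A (weakDeriv (Ω τ) 0)) (A (Ω' τ))
        + 2 * inner ℝ (A (weakDeriv (ω τ) 0)) (A (ω' τ))) (Ico 0 T) τ := fun τ hτ =>
    ((A.hasFDerivAt.comp_hasDerivWithinAt τ (hΩ' τ hτ)).norm_sq).add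
      ((A.hasFDerivAt.comp_hasDerivWithinAt τ (hω' τ hτ)).norm_sq)
  have hbound : ∀ τ ∈ Icc 0 t, 2 * inner ℝ (A (weakDeriv (Ω τ) 0)) (A (Ω' τ))
        + 2 * inner ℝ (A (weakDeriv (ω τ) 0)) (A (ω' τ))
      ≤ 4 * (|a| + 1) * c * R *
        (‖A (weakDeriv (Ω τ) 0)‖ ^ 2 + ‖A (weakDeriv (ω τ) 0)‖ ^ 2) := by
    intro τ hτ
    have hτ' : τ ∈ Ico 0 T := ⟨hτ.1, hτ.2.trans_lt ht.2⟩
    have b1 := energy_rate_bound hv hB hc h1 h2 (hsol.velocity_p τ hτ') (hsol.velocity_m τ hτ')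
      (hΩe τ hτ')
    -- The system is invariant under exchanging `(Ω, p)` with `(ω, m)`.
    have b2 := energy_rate_bound hv hB hc h1 h2 (hsol.velocity_m τ hτ') (hsol.velocity_p τ hτ')
      (hωe τ hτ')
    have hE0 : 0 ≤ En τ := add_nonneg (tsum_nonneg fun _ => sq_nonneg _)
      (tsum_nonneg fun _ => sq_nonneg _)
    have hcR : (|a| + 1) * (c * ((∑' k, ‖coef (weakDeriv (Ω τ) 0) k‖
      + ∑' k, ‖coef (weakDeriv (ω τ) 0) k‖) * En τ)) ≤ (|a| + 1) * (c * (R * En τ)) := by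
      have := hR τ hτ
      gcongr
    rw [add_comm (∑' k, ‖coef (weakDeriv (ω τ) 0) k‖),
      add_comm (∑' k, (v k * ‖coef (weakDeriv (ω τ) 0) k‖) ^ 2)] at b2
    rw [inner_multiplier hA, inner_multiplier hA, hEA]
    have c1 := (le_abs_self _).trans (b1.trans hcR)
    have c2 := (le_abs_self _).trans (b2.trans hcR)
    have hpi := pi_pos
    -- `4π` is the `2` from differentiating a square times the `2π` of Parseval; adding the two
    -- equations gives the remaining `2` in `4 (|a| + 1) c R`.
    have c3 := mul_le_mul_of_nonneg_left (add_le_add c1 c2) (by positivity : 0 ≤ 4 * π)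
    linarith
  have h := le_mul_exp_of_deriv_le hder ht hbound
  simp only [hEA] at h
  rw [mul_assoc (2 * π)] at h
  exact le_of_mul_le_mul_left h (by positivity)

theorem truncWeight_tsum_le {n N : ℕ} {f : CircleL2}
    (hs : Summable fun k : ℤ => ((1 + |(k : ℝ)|) ^ n * ‖coef f k‖) ^ 2) :
    ∑' k, (truncWeight n N k * ‖coef f k‖) ^ 2
      ≤ ∑' k : ℤ, ((1 + |(k : ℝ)|) ^ n * ‖coef f k‖) ^ 2 := by
  refine (summable_weighted_coef (truncWeight_nonneg n N) (truncWeight_le n N) f).tsum_le_tsum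
    (fun k => ?_) hs
  have := truncWeight_nonneg n N k
  have := truncWeight_le_weight n N k
  gcongr

theorem sum_weight_le_of_truncWeight {n : ℕ} {f : CircleL2} {B : ℝ}
    (h : ∀ N, ∑' k, (truncWeight n N k * ‖coef f k‖) ^ 2 ≤ B) (s : Finset ℤ) :
    ∑ k ∈ s, ((1 + |(k : ℝ)|) ^ n * ‖coef f k‖) ^ 2 ≤ B := by
  -- A cutoff beyond every frequency in `s`, where truncated and full weights agree.
  set N := s.sup Int.natAbs
  refine le_trans ?_ (h N)
  refine le_trans (le_of_eq ?_) ((summable_weighted_coef (truncWeight_nonneg n N)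
    (truncWeight_le n N) f).sum_le_tsum s fun _ _ => sq_nonneg _)
  refine Finset.sum_congr rfl fun k hk => ?_
  rw [truncWeight_eq]
  have h1 : k.natAbs ≤ N := Finset.le_sup (f := Int.natAbs) hk
  have h2 : (k.natAbs : ℝ) ≤ N := by exact_mod_cast h1
  rwa [Nat.cast_natAbs, Int.cast_abs] at h2

/-! ### Removal of the cutoff and conclusion. -/

/-- Persistence of `Hⁿ` regularity, controlled by the `H¹` norm. -/
theorem exists_sobolev_bound {a T : ℝ} {n : ℕ} (Ω₀ ω₀ : SobolevSpace n)
    {Ω ω p m : ℝ → SobolevSpace 1} (hsol : IsMHDSolution a T Ω ω p m)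
    (hΩ₀ : weakDeriv (Ω 0) 0 = weakDeriv Ω₀ 0) (hω₀ : weakDeriv (ω 0) 0 = weakDeriv ω₀ 0)
    (M : ℝ) : ∃ C : ℝ, ∀ t ∈ Ico 0 T, (∀ τ ∈ Icc 0 t, ‖Ω τ‖ + ‖ω τ‖ ≤ M) →
      ∃ U V : SobolevSpace n, weakDeriv U 0 = weakDeriv (Ω t) 0 ∧
        weakDeriv V 0 = weakDeriv (ω t) 0 ∧ ‖U‖ + ‖V‖ ≤ C := by
  set S := ∑' k : ℤ, (1 : ℝ) ^ 2 / (1 + (k : ℝ) ^ 2)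
  -- Each `ℓ¹` norm of coefficients is at most `S` plus the squared `H¹` norm, and `‖Ω‖² + ‖ω‖² ≤
  -- M²`.
  set R := 2 * S + M ^ 2
  -- The sum of the constants in `truncWeight_commutator` and `truncWeight_le_add`, so that it
  -- serves for both.
  set c : ℝ := 2 * n * 2 ^ n + 1 + 2 ^ n
  set E₀ := ∑' k : ℤ, ((1 + |(k : ℝ)|) ^ n * ‖coef (weakDeriv Ω₀ 0) k‖) ^ 2
    + ∑' k : ℤ, ((1 + |(k : ℝ)|) ^ n * ‖coef (weakDeriv ω₀ 0) k‖) ^ 2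
  set B := E₀ * Real.exp (4 * (|a| + 1) * c * R * T)
  have hS : 0 ≤ S := tsum_nonneg fun _ => by positivity
  have hR0 : 0 ≤ R := by positivity
  have hc0 : 0 ≤ c := by positivity
  have hE0 : 0 ≤ E₀ := add_nonneg (tsum_nonneg fun _ => sq_nonneg _)
    (tsum_nonneg fun _ => sq_nonneg _)
  refine ⟨2 * Real.sqrt ((n + 1) * (2 * π * B)), fun t ht hM => ?_⟩
  have hmain : ∀ N : ℕ, ∑' k, (truncWeight n N k * ‖coef (weakDeriv (Ω t) 0) k‖) ^ 2
      + ∑' k, (truncWeight n N k * ‖coef (weakDeriv (ω t) 0) k‖) ^ 2 ≤ B := by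
    intro N
    have h := weighted_energy_le hsol (truncWeight_nonneg n N) (truncWeight_le n N)
      (truncWeight_neg n N) hc0 (fun k j => (truncWeight_le_add n N k j).trans ?_)
      (fun k j => (truncWeight_commutator n N k j).trans ?_) (R := R) ht ?_
    · refine h.trans ?_
      rw [hΩ₀, hω₀]
      have h1 := truncWeight_tsum_le (N := N) (summable_weight_coef_of_sobolev Ω₀)
      have h2 := truncWeight_tsum_le (N := N) (summable_weight_coef_of_sobolev ω₀)
      have h3 := add_le_add h1 h2
      have := ht.2.le
      refine mul_le_mul h3 ?_ (Real.exp_pos _).le hE0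
      gcongr
    · have := truncWeight_nonneg n N j
      have := truncWeight_nonneg n N (k - j)
      gcongr
      have : (0 : ℝ) ≤ 2 * n * 2 ^ n + 1 := by positivity
      linarith
    · have := truncWeight_nonneg n N k
      have := truncWeight_nonneg n N j
      have := truncWeight_nonneg n N (k - j)
      gcongr
      have : (0 : ℝ) ≤ 2 ^ n := by positivity
      linarith
    · intro τ hτ
      have h1 := tsum_norm_coef_le (Ω τ)
      have h2 := tsum_norm_coef_le (ω τ)
      have h3 := hM τ hτ
      have h4 : ‖Ω τ‖ ^ 2 + ‖ω τ‖ ^ 2 ≤ M ^ 2 := by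
        have a1 := norm_nonneg (Ω τ)
        have a2 := norm_nonneg (ω τ)
        have a3 := mul_nonneg a1 a2
        have a4 : (‖Ω τ‖ + ‖ω τ‖) ^ 2 ≤ M ^ 2 := by gcongr
        linarith
      refine (add_le_add h1 h2).trans ?_
      change S + _ + (S + _) ≤ 2 * S + M ^ 2
      linarith
  obtain ⟨U, hU, hUn⟩ := exists_sobolev_of_sum_le (sum_weight_le_of_truncWeight
    (n := n) (f := weakDeriv (Ω t) 0) (B := B) fun N =>
      (le_add_of_nonneg_right (tsum_nonneg fun _ => sq_nonneg _)).trans (hmain N))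
  obtain ⟨V, hV, hVn⟩ := exists_sobolev_of_sum_le (sum_weight_le_of_truncWeight
    (n := n) (f := weakDeriv (ω t) 0) (B := B) fun N =>
      (le_add_of_nonneg_left (tsum_nonneg fun _ => sq_nonneg _)).trans (hmain N))
  refine ⟨U, V, hU, hV, ?_⟩
  have := Real.le_sqrt_of_sq_le hUn
  have := Real.le_sqrt_of_sq_le hVn
  linarith

theorem mainTheorem3 (a T : ℝ) (hT : 0 < T) (n : ℕ) (hn : 2 ≤ n)
    (Ω₀ ω₀ : SobolevSpace n)
    (Ω ω p m : ℝ → SobolevSpace 1)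
    (hsol : IsMHDSolution a T Ω ω p m)
    (hΩ₀ : weakDeriv (Ω 0) 0 = weakDeriv Ω₀ 0) (hω₀ : weakDeriv (ω 0) 0 = weakDeriv ω₀ 0)
    (hΩ : ContinuousOn Ω (Set.Ico 0 T)) (hω : ContinuousOn ω (Set.Ico 0 T)) :
    (∀ T' : ℝ, T' < T → SobolevBoundedOn n Ω ω (Set.Icc 0 T')) ∧
    ((∃ M : ℝ, ∀ t ∈ Set.Ico 0 T, ‖Ω t‖ + ‖ω t‖ ≤ M) →
      SobolevBoundedOn n Ω ω (Set.Ico 0 T)) := by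
  refine ⟨fun T' hT' => ?_, fun ⟨M, hM⟩ => ?_⟩
  · have hsub : Icc 0 T' ⊆ Ico 0 T := fun τ hτ => ⟨hτ.1, hτ.2.trans_lt hT'⟩
    -- Continuity into `H¹` on the compact interval supplies the bound that the second claim
    -- assumes.
    obtain ⟨M, hM⟩ := (isCompact_Icc (a := 0) (b := T')).exists_bound_of_continuousOn
      ((hΩ.mono hsub).norm.add (hω.mono hsub).norm)
    obtain ⟨C, hC⟩ := exists_sobolev_bound Ω₀ ω₀ hsol hΩ₀ hω₀ M
    exact ⟨C, fun t ht => hC t (hsub ht) fun τ hτ =>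
      (le_abs_self _).trans (hM τ ⟨hτ.1, hτ.2.trans ht.2⟩)⟩
  · obtain ⟨C, hC⟩ := exists_sobolev_bound Ω₀ ω₀ hsol hΩ₀ hω₀ M
    exact ⟨C, fun t ht => hC t ht fun τ hτ => hM τ ⟨hτ.1, hτ.2.trans_lt ht.2⟩⟩
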